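/- Let $m,n\ge 1$, $L_2>0$, $\alpha\in(0,L_1]$, $\delta\in(0,1)$, $K_1\in\mathbb{R}^{m\times n}$ (with the Frobenius inner product), and let $\psi:\mathbb{R}^{m\times n}\to\mathbb{R}$ be twice continuously differentiable and $L_1$-smooth (its gradient is $L_1$-Lipschitz) with $L_2$-Lipschitz continuous Hessian (in operator norm). Let $\Delta_\psi\ge\psi(K_1)-\inf\psi$ be an optimality gap of $\psi$ at $K_1$ (in particular $\psi$ is bounded below). The Negative Curvature Descent algorithm NCD$(\psi,K_1,\delta,L_2,\alpha,\Delta_\psi)$ sets $\delta'=\delta/(1+12L_2^2\Delta_\psi/\alpha^3)$ and for $j=1,2,\dots$ does the following: by a randomized computation with fresh randomness, find $v_j$ which always satisfies $\|v_j\|=1$ and which, with probability at least $1-\delta'$ (whatever the point $K_j$), satisfies $\lambda_1(\nabla^2\psi(K_j))\ge\nabla^2\psi(K_j)[v_j,v_j]-\alpha/2$, where $\lambda_1$ is the smallest eigenvalue; if $\nabla^2\psi(K_j)[v_j,v_j]\le-\alpha/2$, put $$K_{j+1}=K_j-\frac{2|\nabla^2\psi(K_j)[v_j,v_j]|}{L_2}\,\mathrm{sign}\big(\langle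 v_j,\nabla\psi(K_j)\rangle\big)\,v_j ,\qquad \mathrm{sign}(0):=1;$$ otherwise return $K_j$. Then: 1. For every such eigenvector computation, NCD always terminates, at an iteration $j$ with $$j\le 1+\frac{12L_2^2(\psi(K_1)-\psi(K_j))}{\alpha^3}\le 1+\frac{12L_2^2\Delta_\psi}{\alpha^3},$$ and with probability at least $1-\delta$ the returned point satisfies $\lambda_1(\nabla^2\psi(K_j))\ge-\alpha$. 2. There is an eigenvector computation of this kind with which every iteration of NCD takes time $$O\!\left(T_{\rm grad}\sqrt{\frac{L_1}{\alpha}}\;\max\Big\{1,\log\Big(\frac{mn}{\delta}\Big(1+\frac{12L_2^2\Delta_\psi}{\alpha^3}\Big)\Big)\Big\}\right)$$ with a universal constant. More precisely, one fixed program for a real register machine, which receives $m,n,L_1,L_2,\alpha,\delta,\Delta_\psi$ and the current point as inputs, carries out every such iteration within this time, where each of the following operations takes time $T_{\rm grad}$: evaluating $\nabla\psi(K)$ or $\nabla^2\psi(K)v$, an affine combination or inner product of two matrices, drawing a matrix with independent standard Gaussian entries, loading a fixed matrix unit, and any scalar operation ($+,-,\times,/,\sqrt{\ }$, loading a rational constant)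 or comparison. -/

import Mathlib

open MeasureTheory ProbabilityTheory

noncomputable section

namespace NCD

/-- The space of real `m × n` matrices with the Frobenius inner product and norm, which is
`ℝ^{mn}` with its Euclidean structure (the identification of `K` with `vec K` is built in). -/
abbrev MatSpace (m n : ℕ) : Type := EuclideanSpace ℝ (Fin m × Fin n)

section Calculus

variable {m n : ℕ}

/-- `ψ` is `L`-smooth: its gradient exists everywhere and is Lipschitz with constant `L`. -/
def IsSmooth (L : ℝ) (ψ : MatSpace m n → ℝ) : Prop :=
  Differentiable ℝ ψ ∧ ∀ x y, ‖gradient ψ x - gradient ψ y‖ ≤ L * ‖x - y‖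

/-- The Hessian of `ψ` at `K`, as a linear operator. -/
def hess (ψ : MatSpace m n → ℝ) (K : MatSpace m n) : MatSpace m n →L[ℝ] MatSpace m n :=
  fderiv ℝ (gradient ψ) K

/-- The Hessian quadratic form `∇²ψ(K)[v, v]`. -/
def hessForm (ψ : MatSpace m n → ℝ) (K v : MatSpace m n) : ℝ :=
  inner ℝ v (hess ψ K v)

/-- `ψ` is twice continuously differentiable and its Hessian is Lipschitz with constant `L`
in the operator norm. -/
def HasLipschitzHessian (L : ℝ) (ψ : MatSpace m n → ℝ) : Prop :=
  ContDiff ℝ 2 ψ ∧ ∀ x y, ‖hess ψ x - hess ψ y‖ ≤ L * ‖x - y‖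

/-- The smallest eigenvalue `λ₁(∇²ψ(K))` of the (symmetric) Hessian. -/
def lambdaMin (ψ : MatSpace m n → ℝ) (K : MatSpace m n) : ℝ :=
  sInf {μ : ℝ | Module.End.HasEigenvalue
    (hess ψ K : MatSpace m n →ₗ[ℝ] MatSpace m n) μ}

end Calculus

/-! ### Negative curvature descent -/

section Algorithm

variable {m n : ℕ} {Ω : Type*}

/-- The sign, with the convention `sgn 0 = 1`. -/
def sgn (t : ℝ) : ℝ := if 0 ≤ t then 1 else -1

/-- What follows the eigenvector computation in one iteration, at the point `K` and with the
unit vector `v`: the next point, or `none` if the algorithm stops and returns `K`. -/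
def step (ψ : MatSpace m n → ℝ) (L₂ α : ℝ) (K v : MatSpace m n) : Option (MatSpace m n) :=
  if hessForm ψ K v ≤ -α / 2 then
    some (K - (2 * |hessForm ψ K v| / L₂ * sgn (inner ℝ v (gradient ψ K))) • v)
  else none

/-- The failure probability `δ'` allowed in each eigenvector computation. -/
def innerDelta (δ L₂ α Δ : ℝ) : ℝ := δ / (1 + 12 * L₂ ^ 2 * Δ / α ^ 3)

/-- `eig K ω`, with `ω` drawn from `P`, is a valid randomized eigenvector computation: the
result is always a unit vector and, at every point, with probability at least `1 - δ'`, it is an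
additive `α / 2`-approximate smallest eigenvector of the Hessian. -/
structure IsEigRoutine [MeasurableSpace Ω] (ψ : MatSpace m n → ℝ) (α δ' : ℝ) (P : Measure Ω)
    (eig : MatSpace m n → Ω → MatSpace m n) : Prop where
  measurable : Measurable fun p : MatSpace m n × Ω => eig p.1 p.2
  norm_eq_one : ∀ K ω, ‖eig K ω‖ = 1
  approx : ∀ K, P {ω | ¬ (hessForm ψ K (eig K ω) - α / 2 ≤ lambdaMin ψ K)} ≤ ENNReal.ofReal δ'

/-- The run of the algorithm from `K₁`, where iteration `j + 1` uses the random input `ω j`: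
`iterate … ω j = some K` if the algorithm reaches iteration `j + 1`, at the point `K`, and it is
`none` if the algorithm has returned before. -/
def iterate (ψ : MatSpace m n → ℝ) (L₂ α : ℝ) (eig : MatSpace m n → Ω → MatSpace m n)
    (K₁ : MatSpace m n) (ω : ℕ → Ω) : ℕ → Option (MatSpace m n)
  | 0 => some K₁
  | j + 1 => (iterate ψ L₂ α eig K₁ ω j).bind fun K => step ψ L₂ α K (eig K (ω j))

/-- The algorithm terminates at iteration `j` (counted from `1`) and returns `K`. -/
def ReturnsAt (ψ : MatSpace m n → ℝ) (L₂ α : ℝ) (eig : MatSpace m n → Ω → MatSpace m n)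
    (K₁ : MatSpace m n) (ω : ℕ → Ω) (j : ℕ) (K : MatSpace m n) : Prop :=
  ∃ i, j = i + 1 ∧ iterate ψ L₂ α eig K₁ ω i = some K ∧ iterate ψ L₂ α eig K₁ ω (i + 1) = none

end Algorithm

/-! ### Machine model

A register machine over the reals with vector registers (holding `m × n` matrices) and scalar
registers. Every instruction and every comparison is one operation. -/

section Machine

/-- Instructions; the first argument is the register that receives the result. -/
inductive Instr : Type
  /-- gradient of the objective at vector register `i` -/
  | grad (dst i : ℕ)
  /-- Hessian of the objective at vector register `i`, applied to vector register `j` -/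
  | hessVec (dst i j : ℕ)
  /-- affine combination `a • i + b • j` of vector registers with scalar registers `a`, `b` -/
  | lin (dst a i b j : ℕ)
  /-- inner product of two vector registers -/
  | inner (dst i j : ℕ)
  /-- draw a fresh standard Gaussian matrix -/
  | gauss (dst : ℕ)
  /-- load the matrix whose only nonzero entry is a `1` in the first row and column -/
  | unitVec (dst : ℕ)
  /-- scalar instructions -/
  | const (dst : ℕ) (c : ℚ)
  | add (dst a b : ℕ)
  | sub (dst a b : ℕ)
  | mul (dst a b : ℕ)
  | div (dst a b : ℕ)
  | sqrt (dst a : ℕ)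

/-- Programs: the text of a program mentions neither the dimensions nor the objective. -/
inductive Prog : Type
  | instr (i : Instr)
  | seq (p q : Prog)
  /-- `ifLe a b p q`: if scalar register `a` is at most scalar register `b` then `p` else `q` -/
  | ifLe (a b : ℕ) (p q : Prog)
  /-- `whileLe a b p`: repeat `p` as long as scalar register `a` is at most register `b` -/
  | whileLe (a b : ℕ) (p : Prog)

/-- Memory contents; `drawn` counts the Gaussian matrices drawn so far. -/
structure State (m n : ℕ) : Type where
  vec : ℕ → MatSpace m n
  scal : ℕ → ℝ
  drawn : ℕ

variable {m n : ℕ}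

/-- The matrix unit in the first row and column (`0` if there are no entries). -/
def firstUnit (m n : ℕ) : MatSpace m n :=
  if h : 0 < m ∧ 0 < n then EuclideanSpace.single (⟨0, h.1⟩, ⟨0, h.2⟩) 1 else 0

/-- Store a vector. -/
def State.setVec (σ : State m n) (dst : ℕ) (x : MatSpace m n) : State m n :=
  { σ with vec := Function.update σ.vec dst x }

/-- Store a scalar. -/
def State.setScal (σ : State m n) (dst : ℕ) (c : ℝ) : State m n :=
  { σ with scal := Function.update σ.scal dst c }

/-- Effect of an instruction, for the objective `ψ` and the sequence `u` of random matrices. -/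
def Instr.eval (ψ : MatSpace m n → ℝ) (u : ℕ → MatSpace m n) (σ : State m n) :
    Instr → State m n
  | .grad dst i => σ.setVec dst (gradient ψ (σ.vec i))
  | .hessVec dst i j => σ.setVec dst (hess ψ (σ.vec i) (σ.vec j))
  | .lin dst a i b j => σ.setVec dst (σ.scal a • σ.vec i + σ.scal b • σ.vec j)
  | .inner dst i j => σ.setScal dst (Inner.inner ℝ (σ.vec i) (σ.vec j))
  | .gauss dst => { σ.setVec dst (u σ.drawn) with drawn := σ.drawn + 1 }
  | .unitVec dst => σ.setVec dst (firstUnit m n)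
  | .const dst c => σ.setScal dst (c : ℝ)
  | .add dst a b => σ.setScal dst (σ.scal a + σ.scal b)
  | .sub dst a b => σ.setScal dst (σ.scal a - σ.scal b)
  | .mul dst a b => σ.setScal dst (σ.scal a * σ.scal b)
  | .div dst a b => σ.setScal dst (σ.scal a / σ.scal b)
  | .sqrt dst a => σ.setScal dst (Real.sqrt (σ.scal a))

/-- `Exec ψ u p σ τ t`: started in state `σ`, the program `p` halts in state `τ` after exactly
`t` operations (instructions and comparisons). -/
inductive Exec (ψ : MatSpace m n → ℝ) (u : ℕ → MatSpace m n) :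
    Prog → State m n → State m n → ℕ → Prop
  | instr (i : Instr) (σ : State m n) : Exec ψ u (.instr i) σ (i.eval ψ u σ) 1
  | seq {p q : Prog} {σ τ ρ : State m n} {s t : ℕ} :
      Exec ψ u p σ τ s → Exec ψ u q τ ρ t → Exec ψ u (.seq p q) σ ρ (s + t)
  | ifTrue {a b : ℕ} {p q : Prog} {σ τ : State m n} {t : ℕ} :
      σ.scal a ≤ σ.scal b → Exec ψ u p σ τ t → Exec ψ u (.ifLe a b p q) σ τ (t + 1)
  | ifFalse {a b : ℕ} {p q : Prog} {σ τ : State m n} {t : ℕ} :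
      ¬ σ.scal a ≤ σ.scal b → Exec ψ u q σ τ t → Exec ψ u (.ifLe a b p q) σ τ (t + 1)
  | whileTrue {a b : ℕ} {p : Prog} {σ τ ρ : State m n} {s t : ℕ} :
      σ.scal a ≤ σ.scal b → Exec ψ u p σ τ s → Exec ψ u (.whileLe a b p) τ ρ t →
        Exec ψ u (.whileLe a b p) σ ρ (s + t + 1)
  | whileFalse {a b : ℕ} {p : Prog} {σ : State m n} :
      ¬ σ.scal a ≤ σ.scal b → Exec ψ u (.whileLe a b p) σ σ 1

/-- Initial memory: the current point in vector register `0`, the parameters in scalar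
registers `1` to `7`. -/
def initial (m n : ℕ) (L₁ L₂ α δ Δ : ℝ) (K : MatSpace m n) : State m n where
  vec i := if i = 0 then K else 0
  scal
    | 1 => m
    | 2 => n
    | 3 => L₁
    | 4 => L₂
    | 5 => α
    | 6 => δ
    | 7 => Δ
    | _ => 0
  drawn := 0

/-- Output of an iteration: stop if scalar register `0` holds `0`, otherwise continue with the
point in vector register `0`. -/
def State.output (σ : State m n) : Option (MatSpace m n) :=
  if σ.scal 0 = 0 then none else some (σ.vec 0)

/-- Law of the random input of one iteration: independent standard Gaussian matrices. -/
def gaussLaw (m n : ℕ) : Measure (ℕ → MatSpace m n) :=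
  Measure.infinitePi fun _ => stdGaussian (MatSpace m n)

end Machine

end NCD

end

/-!
**Termination and correctness.** A descent step of length `2 |h| / L₂` along a direction of
curvature `h ≤ -α / 2`, with the sign chosen against the gradient, lowers `ψ` by at least
`α³ / (12 L₂²)` by the second-order Taylor bound (`decrease_of_step`), so the optimality gap limits
the number of iterations. The input of an iteration is independent of the point it is applied to
(`indepFun_trajectory`), hence each eigenvector computation fails with probability at most `δ'`,
and a union bound over the possible iterations gives `δ`.

**The eigenvector computation.** A program has only finitely many registers, so the Lanczos basis
cannot be stored; instead a Chebyshev polynomial of the Hessian is applied to one Gaussian vector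
by the three-term recurrence. Such a filter has to be told which part of the spectrum to suppress.
The search therefore proceeds in stages: given a unit vector whose Rayleigh quotient `h` exceeds
`λ₁` by at most `ε`, the filter suppresses the spectrum above `θ = h - 7 ε / 16`, and its output is
accepted if its Rayleigh quotient is below `θ`. If `λ₁` is lower than `θ - ε / 8` the output is
always accepted (`hessForm_chebVec_lt`); otherwise `h - λ₁ ≤ 9 ε / 16` already. Either way `ε`
shrinks by the factor `9 / 16` (`hessForm_filterStep_le`). All stages share the same start vector
and are deterministic given that this vector is not nearly orthogonal to a lowest eigenvector,
which is the only random event (`stdGaussian_not_aligned_le`).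

**Running time.** A stage needs `O(√(L₁ / ε) log (mn / δ'))` operations. Two points keep the
logarithm free of `L₁ / α`. First, the polynomials `p` are of the fourth kind, which satisfy
`p(y)² (1 - y) ≤ 2` and not merely `|p(y)| ≤ 1` on `[-1, 1]`: this weighs each eigenvalue by its
excess in the Rayleigh quotient (`cheb_sq_mul_one_sub_le`). Secondly, the stage costs form a
geometric series, so that the last stage, with `ε` of order `α`, dominates (`total_cost_le`). The
machine has no logarithm, and finds the degree by running the scalar recurrence alongside the
vector one until the amplification is large enough.
-/

noncomputable section

namespace NCD

/-! ### Calculus of the objective and the descent step -/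

section Calculus
variable {m n : ℕ} {ψ : MatSpace m n → ℝ} {L₁ L₂ : ℝ}

lemma HasLipschitzHessian.differentiable (h : HasLipschitzHessian L₂ ψ) : Differentiable ℝ ψ :=
  h.1.differentiable (by norm_num)

lemma contDiff_gradient (h : ContDiff ℝ 2 ψ) : ContDiff ℝ 1 (gradient ψ) := by
  have h1 : ContDiff ℝ 1 (fderiv ℝ ψ) := h.fderiv_right (by norm_num)
  exact (InnerProductSpace.toDual ℝ (MatSpace m n)).symm.toContinuousLinearEquiv.contDiff.comp h1

lemma differentiable_gradient (h : ContDiff ℝ 2 ψ) : Differentiable ℝ (gradient ψ) :=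
  (contDiff_gradient h).differentiable (by norm_num)

lemma continuous_hess (h : ContDiff ℝ 2 ψ) : Continuous (hess ψ) :=
  (contDiff_gradient h).continuous_fderiv (by norm_num)

lemma inner_gradient (K v : MatSpace m n) : inner ℝ (gradient ψ K) v = fderiv ℝ ψ K v := by
  simp [gradient, InnerProductSpace.toDual_symm_apply]

lemma inner_hess (h : ContDiff ℝ 2 ψ) (K v w : MatSpace m n) :
    inner ℝ (hess ψ K v) w = fderiv ℝ (fderiv ℝ ψ) K v w := by
  have h1 : DifferentiableAt ℝ (fderiv ℝ ψ) K :=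
    (h.fderiv_right (m := 1) (by norm_num)).differentiable (by norm_num) K
  have h2 : hess ψ K v =
      (InnerProductSpace.toDual ℝ (MatSpace m n)).symm (fderiv ℝ (fderiv ℝ ψ) K v) := by
    have := ((InnerProductSpace.toDual ℝ (MatSpace m
      n)).symm.toContinuousLinearEquiv.toContinuousLinearMap.hasFDerivAt.comp K
      h1.hasFDerivAt).fderiv
    exact congrArg (fun T => T v) this
  rw [h2, InnerProductSpace.toDual_symm_apply]

lemma hess_symm (h : ContDiff ℝ 2 ψ) (K v w : MatSpace m n) :
    inner ℝ (hess ψ K v) w = inner ℝ v (hess ψ K w) := by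
  rw [inner_hess h, real_inner_comm, inner_hess h]
  exact (h.contDiffAt.isSymmSndFDerivAt (by simp)) v w

lemma hess_isSymmetric (h : ContDiff ℝ 2 ψ) (K : MatSpace m n) :
    (hess ψ K : MatSpace m n →ₗ[ℝ] MatSpace m n).IsSymmetric :=
  fun v w => hess_symm h K v w

lemma norm_hess_le (h : IsSmooth L₁ ψ) (hL : 0 ≤ L₁) (K : MatSpace m n) :
    ‖hess ψ K‖ ≤ L₁ :=
  norm_fderiv_le_of_lip' ℝ hL (Filter.Eventually.of_forall fun x => h.2 x K)

lemma abs_hessForm_le (K v : MatSpace m n) :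
    |hessForm ψ K v| ≤ ‖hess ψ K‖ * ‖v‖ ^ 2 := by
  refine (abs_real_inner_le_norm _ _).trans ?_
  nlinarith [(hess ψ K).le_opNorm v, norm_nonneg v]

/-- Second-order Taylor bound for a function with a Lipschitz Hessian. -/
lemma taylor_le (h : HasLipschitzHessian L₂ ψ) (x d : MatSpace m n) :
    ψ (x + d) ≤ ψ x + inner ℝ d (gradient ψ x) + hessForm ψ x d / 2 + L₂ * ‖d‖ ^ 3 / 6 := by
  have hline : ∀ t : ℝ, HasDerivAt (fun t : ℝ => x + t • d) d t := fun t => by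
    simpa using ((hasDerivAt_id t).smul_const d).const_add x
  have h1 : ∀ t : ℝ, HasDerivAt (fun t : ℝ => ψ (x + t • d))
      (inner ℝ d (gradient ψ (x + t • d))) t := fun t => by
    have := (h.differentiable (x + t • d)).hasFDerivAt.comp_hasDerivAt t (hline t)
    rwa [← inner_gradient, real_inner_comm] at this
  have h2 : ∀ t : ℝ, HasDerivAt (fun t : ℝ => inner ℝ d (gradient ψ (x + t • d)))
      (hessForm ψ (x + t • d) d) t := fun t => by
    have h3 := (differentiable_gradient h.1 (x + t • d)).hasFDerivAt.comp_hasDerivAt t (hline t)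
    have := (hasDerivAt_const t d).inner ℝ h3
    simpa [hessForm, hess] using this
  have hb : ∀ t : ℝ, 0 ≤ t → hessForm ψ (x + t • d) d ≤ hessForm ψ x d + L₂ * ‖d‖ ^ 3 * t := by
    intro t ht
    have e : hessForm ψ (x + t • d) d - hessForm ψ x d
        = inner ℝ d ((hess ψ (x + t • d) - hess ψ x) d) := by
      simp [hessForm, inner_sub_right]
    have h3 := (real_inner_le_norm d ((hess ψ (x + t • d) - hess ψ x) d))
    have h4 := (hess ψ (x + t • d) - hess ψ x).le_opNorm d
    have h5 := h.2 (x + t • d) x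
    rw [add_sub_cancel_left, norm_smul, Real.norm_of_nonneg ht] at h5
    have h6 : ‖d‖ * ‖(hess ψ (x + t • d) - hess ψ x) d‖ ≤ ‖d‖ * ((L₂ * (t * ‖d‖)) * ‖d‖) := by
      gcongr
      exact h4.trans (by gcongr)
    nlinarith
  have hg1 : ∀ t : ℝ, HasDerivAt (fun t : ℝ => inner ℝ d (gradient ψ x) + hessForm ψ x d * t
      + L₂ * ‖d‖ ^ 3 * t ^ 2 / 2 - inner ℝ d (gradient ψ (x + t • d)))
      (hessForm ψ x d + L₂ * ‖d‖ ^ 3 * t - hessForm ψ (x + t • d) d) t := fun t => by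
    refine HasDerivAt.sub (HasDerivAt.add ?_ ?_) (h2 t)
    · simpa using ((hasDerivAt_id t).const_mul (hessForm ψ x d)).const_add
        (inner ℝ d (gradient ψ x))
    · exact (((hasDerivAt_pow 2 t).const_mul (L₂ * ‖d‖ ^ 3)).div_const 2).congr_deriv
        (by push_cast; ring)
  have hg0 : ∀ t : ℝ, HasDerivAt (fun t : ℝ => ψ x + inner ℝ d (gradient ψ x) * t
      + hessForm ψ x d * t ^ 2 / 2
      + L₂ * ‖d‖ ^ 3 * t ^ 3 / 6 - ψ (x + t • d))
      (inner ℝ d (gradient ψ x) + hessForm ψ x d * t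
      + L₂ * ‖d‖ ^ 3 * t ^ 2 / 2 - inner ℝ d (gradient ψ (x + t • d))) t := fun t => by
    refine HasDerivAt.sub (HasDerivAt.add (HasDerivAt.add ?_ ?_) ?_) (h1 t)
    · simpa using ((hasDerivAt_id t).const_mul (inner ℝ d (gradient ψ x))).const_add (ψ x)
    · exact (((hasDerivAt_pow 2 t).const_mul (hessForm ψ x d)).div_const 2).congr_deriv
        (by push_cast; ring)
    · exact (((hasDerivAt_pow 3 t).const_mul (L₂ * ‖d‖ ^ 3)).div_const 6).congr_deriv
        (by push_cast; ring)
  -- The bound minus `ψ` along the segment, and its derivative, vanish at `0`; the second derivative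
  -- is nonnegative by `hb`, so both are monotone and nonnegative.
  have m1 := monotoneOn_of_hasDerivWithinAt_nonneg (convex_Ici (0 : ℝ))
    (fun t _ => (hg1 t).continuousAt.continuousWithinAt)
    (fun t _ => (hg1 t).hasDerivWithinAt) (fun t ht => by
      rw [interior_Ici] at ht
      have := hb t ht.le
      linarith)
  have m0 := monotoneOn_of_hasDerivWithinAt_nonneg (convex_Ici (0 : ℝ))
    (fun t _ => (hg0 t).continuousAt.continuousWithinAt)
    (fun t _ => (hg0 t).hasDerivWithinAt) (fun t ht => by
      rw [interior_Ici] at ht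
      have := m1 (Set.mem_Ici.2 le_rfl) (Set.mem_Ici.2 ht.le) ht.le
      simpa using this)
  have := m0 (Set.mem_Ici.2 le_rfl) (Set.mem_Ici.2 zero_le_one) zero_le_one
  rw [real_inner_comm, inner_gradient]
  simp at this
  linarith

lemma abs_sgn (t : ℝ) : |sgn t| = 1 := by
  unfold sgn; split_ifs <;> simp

lemma sgn_mul_self (t : ℝ) : sgn t * t = |t| := by
  unfold sgn; split_ifs with h
  · rw [abs_of_nonneg h, one_mul]
  · rw [abs_of_neg (not_le.1 h)]; ring

/-- The sign makes the first-order term of the Taylor expansion nonpositive, and the step length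
`2 |h| / L₂` balances the second-order gain against the third-order error. -/
lemma decrease_of_step {α : ℝ} (h : HasLipschitzHessian L₂ ψ) (hL : 0 < L₂) (hα : 0 < α)
    {K v K' : MatSpace m n} (hv : ‖v‖ = 1) (hs : step ψ L₂ α K v = some K') :
    ψ K' ≤ ψ K - α ^ 3 / (12 * L₂ ^ 2) := by
  unfold step at hs
  split_ifs at hs with hc
  simp only [Option.some.injEq] at hs
  set s := sgn (inner ℝ v (gradient ψ K)) with hsdef
  set q := |hessForm ψ K v| with hq
  have hq' : hessForm ψ K v = -q := by rw [hq, abs_of_nonpos (by linarith)]; ring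
  have hqα : α / 2 ≤ q := by linarith
  have hq0 : 0 < q := by linarith
  set η := 2 * q / L₂ with hη
  have hη0 : 0 < η := by positivity
  have hss : s ^ 2 = 1 := by rw [← sq_abs, abs_sgn]; norm_num
  have ht := taylor_le h K (-((η * s) • v))
  have e1 : inner ℝ (-((η * s) • v)) (gradient ψ K) = -(η * |inner ℝ v (gradient ψ K)|) := by
    rw [← sgn_mul_self, ← hsdef, inner_neg_left, real_inner_smul_left]; ring
  have e2 : hessForm ψ K (-((η * s) • v)) = -(η ^ 2 * q) := by
    have : hessForm ψ K (-((η * s) • v)) = (η * s) ^ 2 * hessForm ψ K v := by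
      simp only [hessForm, map_neg, map_smul, inner_neg_left, inner_neg_right,
        real_inner_smul_left, real_inner_smul_right]; ring
    rw [this, mul_pow, hss, hq']; ring
  have e3 : ‖-((η * s) • v)‖ = η := by
    rw [norm_neg, norm_smul, hv, Real.norm_eq_abs, abs_mul, abs_sgn, abs_of_pos hη0]; ring
  rw [e1, e2, e3, ← sub_eq_add_neg, hs] at ht
  have h1 : 0 ≤ η * |inner ℝ v (gradient ψ K)| := by positivity
  have e4 : -(η ^ 2 * q) / 2 + L₂ * η ^ 3 / 6 = -(2 * q ^ 3 / (3 * L₂ ^ 2)) := by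
    rw [hη]; field_simp; ring
  have h2 : α ^ 3 / (12 * L₂ ^ 2) ≤ 2 * q ^ 3 / (3 * L₂ ^ 2) := by
    rw [div_le_div_iff₀ (by positivity) (by positivity)]
    have : (α / 2) ^ 3 ≤ q ^ 3 := by gcongr
    nlinarith [sq_nonneg L₂, pow_pos hL 2]
  linarith

end Calculus

/-! ### The smallest eigenvalue of the Hessian -/

section Spectrum
variable {m n : ℕ} {ψ : MatSpace m n → ℝ} {L₁ L₂ : ℝ}

/-- Spectral theorem for the Hessian: an orthonormal eigenbasis, one of whose members belongs to
the smallest eigenvalue. -/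
lemma exists_eigenbasis (h : ContDiff ℝ 2 ψ) (hm : 1 ≤ m) (hn : 1 ≤ n) (K : MatSpace m n) :
    ∃ (b : OrthonormalBasis (Fin (m * n)) ℝ (MatSpace m n)) (ev : Fin (m * n) → ℝ)
      (i₀ : Fin (m * n)), (∀ i, hess ψ K (b i) = ev i • b i) ∧ ev i₀ = lambdaMin ψ K ∧
      ∀ i, lambdaMin ψ K ≤ ev i := by
  have hT := hess_isSymmetric h K
  have hd : Module.finrank ℝ (MatSpace m n) = m * n := by simp
  have hpos : 0 < m * n := Nat.mul_pos hm hn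
  have hset : {μ : ℝ | Module.End.HasEigenvalue
      (hess ψ K : MatSpace m n →ₗ[ℝ] MatSpace m n) μ} = Set.range (hT.eigenvalues hd) := by
    ext μ
    constructor
    · intro hμ
      exact hT.exists_eigenvalues_eq hd hμ
    · rintro ⟨i, rfl⟩
      exact hT.hasEigenvalue_eigenvalues hd i
  have hfin : (Set.range (hT.eigenvalues hd)).Finite := Set.finite_range _
  have hne : (Set.range (hT.eigenvalues hd)).Nonempty := ⟨_, ⟨0, hpos⟩, rfl⟩
  obtain ⟨i₀, hi₀⟩ := hne.csInf_mem hfin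
  refine ⟨hT.eigenvectorBasis hd, hT.eigenvalues hd, i₀, fun i => ?_, ?_, fun i => ?_⟩
  · exact hT.apply_eigenvectorBasis hd i
  · rw [hi₀, lambdaMin, hset]
  · rw [lambdaMin, hset]
    exact csInf_le hfin.bddBelow ⟨i, rfl⟩

lemma inner_hess_eigenvector (h : ContDiff ℝ 2 ψ) {K e : MatSpace m n} {μ : ℝ}
    (he : hess ψ K e = μ • e) (w : MatSpace m n) :
    inner ℝ e (hess ψ K w) = μ * inner ℝ e w := by
  rw [← hess_symm h, he, real_inner_smul_left]

lemma hessForm_eq_sum (h : ContDiff ℝ 2 ψ) {K : MatSpace m n} {ι : Type*} [Fintype ι]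
    (b : OrthonormalBasis ι ℝ (MatSpace m n)) (ev : ι → ℝ)
    (hb : ∀ i, hess ψ K (b i) = ev i • b i) (w : MatSpace m n) :
    hessForm ψ K w = ∑ i, ev i * inner ℝ (b i) w ^ 2 := by
  rw [hessForm, ← b.sum_inner_mul_inner]
  refine Finset.sum_congr rfl fun i _ => ?_
  rw [inner_hess_eigenvector h (hb i), real_inner_comm]; ring

lemma lambdaMin_mul_le_hessForm (h : ContDiff ℝ 2 ψ) (hm : 1 ≤ m) (hn : 1 ≤ n)
    (K v : MatSpace m n) : lambdaMin ψ K * ‖v‖ ^ 2 ≤ hessForm ψ K v := by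
  obtain ⟨b, ev, i₀, hb, -, hle⟩ := exists_eigenbasis h hm hn K
  rw [hessForm_eq_sum h b ev hb, ← b.sum_sq_inner_right, Finset.mul_sum]
  gcongr with i
  exact hle i

lemma exists_unit_hessForm_eq (h : ContDiff ℝ 2 ψ) (hm : 1 ≤ m) (hn : 1 ≤ n)
    (K : MatSpace m n) : ∃ v, ‖v‖ = 1 ∧ hessForm ψ K v = lambdaMin ψ K := by
  obtain ⟨b, ev, i₀, hb, he, -⟩ := exists_eigenbasis h hm hn K
  refine ⟨b i₀, b.norm_eq_one i₀, ?_⟩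
  rw [hessForm, hb, he, real_inner_smul_right, real_inner_self_eq_norm_sq, b.norm_eq_one]; simp

/-- The smallest eigenvalue is `1`-Lipschitz in the operator norm: test the form at `x` with a lowest
eigenvector at `y`. -/
lemma lambdaMin_le_add (h : ContDiff ℝ 2 ψ) (hm : 1 ≤ m) (hn : 1 ≤ n)
    (x y : MatSpace m n) : lambdaMin ψ x ≤ lambdaMin ψ y + ‖hess ψ x - hess ψ y‖ := by
  obtain ⟨v, hv, he⟩ := exists_unit_hessForm_eq h hm hn y
  have h1 := lambdaMin_mul_le_hessForm h hm hn x v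
  have e : hessForm ψ x v = hessForm ψ y v + inner ℝ v ((hess ψ x - hess ψ y) v) := by
    simp [hessForm, inner_sub_right]
  have h3 := (real_inner_le_norm v ((hess ψ x - hess ψ y) v))
  have h4 := (hess ψ x - hess ψ y).le_opNorm v
  rw [hv] at h1 h3 h4
  linarith

lemma continuous_lambdaMin (h : ContDiff ℝ 2 ψ) (hm : 1 ≤ m) (hn : 1 ≤ n) :
    Continuous (lambdaMin ψ : MatSpace m n → ℝ) := by
  rw [continuous_iff_continuousAt]
  intro x
  rw [ContinuousAt, tendsto_iff_dist_tendsto_zero]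
  have h0 : Filter.Tendsto (fun y => ‖hess ψ y - hess ψ x‖) (nhds x) (nhds 0) := by
    have := ((continuous_hess h).sub (continuous_const (y := hess ψ x))).norm.tendsto x
    simpa using this
  refine squeeze_zero (fun _ => dist_nonneg) (fun y => ?_) h0
  rw [Real.dist_eq, abs_le]
  have h1 := lambdaMin_le_add h hm hn x y
  have h2 := lambdaMin_le_add h hm hn y x
  rw [norm_sub_rev] at h1
  constructor <;> linarith

lemma neg_le_lambdaMin (h : ContDiff ℝ 2 ψ) (hs : IsSmooth L₁ ψ) (hL : 0 ≤ L₁) (hm : 1 ≤ m)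
    (hn : 1 ≤ n) (K : MatSpace m n) : -L₁ ≤ lambdaMin ψ K := by
  obtain ⟨v, hv, he⟩ := exists_unit_hessForm_eq h hm hn K
  have h1 := abs_hessForm_le (ψ := ψ) K v
  rw [hv, he] at h1
  have h2 := norm_hess_le hs hL K
  have := (abs_le.1 h1).1
  linarith

end Spectrum

/-! ### Termination -/

section Termination
variable {m n : ℕ} {Ω : Type*} {ψ : MatSpace m n → ℝ} {L₂ α Δ δ : ℝ} {K₁ : MatSpace m n}
  {eig : MatSpace m n → Ω → MatSpace m n}

lemma le_of_iterate_eq_some (h : HasLipschitzHessian L₂ ψ) (hL : 0 < L₂) (hα : 0 < α)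
    (hv : ∀ K ω, ‖eig K ω‖ = 1) (ω : ℕ → Ω) (i : ℕ) (K : MatSpace m n)
    (hi : iterate ψ L₂ α eig K₁ ω i = some K) :
    ψ K ≤ ψ K₁ - i * (α ^ 3 / (12 * L₂ ^ 2)) := by
  induction i generalizing K with
  | zero => simp only [iterate, Option.some.injEq] at hi; simp [hi]
  | succ i ih =>
    simp only [iterate, Option.bind_eq_some_iff] at hi
    obtain ⟨K', h1, h2⟩ := hi
    have := ih K' h1
    have := decrease_of_step h hL hα (hv K' (ω i)) h2
    push_cast
    linarith

lemma exists_returnsAt (h : HasLipschitzHessian L₂ ψ) (hL : 0 < L₂) (hα : 0 < α)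
    (hΔ : ∀ K, ψ K₁ - ψ K ≤ Δ) (hv : ∀ K ω, ‖eig K ω‖ = 1) (ω : ℕ → Ω) :
    ∃ j K, ReturnsAt ψ L₂ α eig K₁ ω j K := by
  have hc : 0 < α ^ 3 / (12 * L₂ ^ 2) := by positivity
  have hex : ∃ i, iterate ψ L₂ α eig K₁ ω i = none := by
    obtain ⟨i, hi⟩ := exists_nat_gt (Δ / (α ^ 3 / (12 * L₂ ^ 2)))
    refine ⟨i, ?_⟩
    by_contra hne
    obtain ⟨K, hK⟩ := Option.ne_none_iff_exists'.1 hne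
    have h1 := le_of_iterate_eq_some h hL hα hv ω i K hK
    have h2 := hΔ K
    rw [div_lt_iff₀ hc] at hi
    linarith
  classical
  have h0 : Nat.find hex ≠ 0 := by
    intro h0
    have := Nat.find_spec hex
    rw [h0] at this
    simp [iterate] at this
  obtain ⟨i, hi⟩ := Nat.exists_eq_succ_of_ne_zero h0
  have hlt := Nat.find_min hex (m := i) (by omega)
  obtain ⟨K, hK⟩ := Option.ne_none_iff_exists'.1 hlt
  refine ⟨i + 1, K, i, rfl, hK, ?_⟩
  have := Nat.find_spec hex
  rwa [hi] at this

lemma le_of_returnsAt (h : HasLipschitzHessian L₂ ψ) (hL : 0 < L₂) (hα : 0 < α)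
    (hv : ∀ K ω, ‖eig K ω‖ = 1) {ω : ℕ → Ω} {j : ℕ} {K : MatSpace m n}
    (hr : ReturnsAt ψ L₂ α eig K₁ ω j K) :
    (j : ℝ) ≤ 1 + 12 * L₂ ^ 2 * (ψ K₁ - ψ K) / α ^ 3 := by
  obtain ⟨i, rfl, hi, -⟩ := hr
  have h1 := le_of_iterate_eq_some h hL hα hv ω i K hi
  have h2 : (i : ℝ) ≤ 12 * L₂ ^ 2 * (ψ K₁ - ψ K) / α ^ 3 := by
    rw [le_div_iff₀ (by positivity)]
    have h3 : (i : ℝ) * (α ^ 3 / (12 * L₂ ^ 2)) ≤ ψ K₁ - ψ K := by linarith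
    rw [mul_div_assoc', div_le_iff₀ (by positivity)] at h3
    linarith
  push_cast
  linarith

end Termination

/-! ### Failure probability of the whole run -/

section Probability
variable {m n : ℕ} {Ω : Type*} {ψ : MatSpace m n → ℝ} {L₂ α Δ δ : ℝ} {K₁ : MatSpace m n}
  {eig : MatSpace m n → Ω → MatSpace m n}

/-- The trajectory of the algorithm, frozen at the returned point once it has stopped. -/
def trajectory (ψ : MatSpace m n → ℝ) (L₂ α : ℝ) (eig : MatSpace m n → Ω → MatSpace m n)
    (K₁ : MatSpace m n) (ω : ℕ → Ω) : ℕ → MatSpace m n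
  | 0 => K₁
  | j + 1 => (step ψ L₂ α (trajectory ψ L₂ α eig K₁ ω j)
      (eig (trajectory ψ L₂ α eig K₁ ω j) (ω j))).getD (trajectory ψ L₂ α eig K₁ ω j)

/-- Working with a total trajectory avoids measurability questions about `Option`. -/
lemma trajectory_eq_of_iterate (ω : ℕ → Ω) (i : ℕ) (K : MatSpace m n)
    (hi : iterate ψ L₂ α eig K₁ ω i = some K) : trajectory ψ L₂ α eig K₁ ω i = K := by
  induction i generalizing K with
  | zero => simpa [iterate, trajectory] using hi
  | succ i ih =>
    simp only [iterate, Option.bind_eq_some_iff] at hi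
    obtain ⟨K', h1, h2⟩ := hi
    rw [trajectory, ih K' h1, h2, Option.getD_some]

lemma trajectory_congr {ω ω' : ℕ → Ω} {i : ℕ} (h : ∀ k < i, ω k = ω' k) :
    trajectory ψ L₂ α eig K₁ ω i = trajectory ψ L₂ α eig K₁ ω' i := by
  induction i with
  | zero => rfl
  | succ i ih =>
    rw [trajectory, trajectory, ih fun k hk => h k (by omega), h i (by omega)]

lemma measurable_sgn : Measurable sgn :=
  Measurable.ite measurableSet_Ici measurable_const measurable_const

lemma measurable_hessForm (h : ContDiff ℝ 2 ψ) {Ξ : Type*} [MeasurableSpace Ξ]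
    {f g : Ξ → MatSpace m n} (hf : Measurable f) (hg : Measurable g) :
    Measurable fun x => hessForm ψ (f x) (g x) := by
  have h1 : Measurable fun p : MatSpace m n × MatSpace m n => hess ψ p.1 p.2 :=
    (((continuous_hess h).comp continuous_fst).clm_apply continuous_snd).measurable
  exact hg.inner (h1.comp (hf.prodMk hg))

lemma measurable_step_getD (h : ContDiff ℝ 2 ψ) {Ξ : Type*} [MeasurableSpace Ξ]
    {f g : Ξ → MatSpace m n} (hf : Measurable f) (hg : Measurable g) :
    Measurable fun x => (step ψ L₂ α (f x) (g x)).getD (f x) := by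
  have hq := measurable_hessForm h hf hg
  have hgr : Measurable fun x => gradient ψ (f x) :=
    (contDiff_gradient h).continuous.measurable.comp hf
  have e : (fun x => (step ψ L₂ α (f x) (g x)).getD (f x)) =
      fun x => if hessForm ψ (f x) (g x) ≤ -α / 2 then
        f x - (2 * |hessForm ψ (f x) (g x)| / L₂ * sgn (inner ℝ (g x) (gradient ψ (f x)))) • g x
        else f x := by
    funext x
    unfold step
    split_ifs <;> rfl
  rw [e]
  have hs : Measurable fun x => sgn (inner ℝ (g x) (gradient ψ (f x))) :=
    measurable_sgn.comp (hg.inner hgr)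
  have ha : Measurable fun x => |hessForm ψ (f x) (g x)| := hq.abs
  exact Measurable.ite (measurableSet_le hq measurable_const)
    (hf.sub ((((ha.const_mul 2).div_const L₂).mul hs).smul hg)) hf

variable [MeasurableSpace Ω]

lemma measurable_trajectory (h : ContDiff ℝ 2 ψ)
    (he : Measurable fun p : MatSpace m n × Ω => eig p.1 p.2) (i : ℕ) :
    Measurable fun ω => trajectory ψ L₂ α eig K₁ ω i := by
  induction i with
  | zero => exact measurable_const
  | succ i ih =>
    have h1 : Measurable fun ω : ℕ → Ω => eig (trajectory ψ L₂ α eig K₁ ω i) (ω i) :=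
      he.comp (ih.prodMk (measurable_pi_apply i))
    simp only [trajectory]
    exact measurable_step_getD h ih h1

lemma measurableSet_not_approx (h : ContDiff ℝ 2 ψ) (hm : 1 ≤ m) (hn : 1 ≤ n)
    (he : Measurable fun p : MatSpace m n × Ω => eig p.1 p.2) :
    MeasurableSet {p : MatSpace m n × Ω |
      ¬ (hessForm ψ p.1 (eig p.1 p.2) - α / 2 ≤ lambdaMin ψ p.1)} := by
  have h1 : Measurable fun p : MatSpace m n × Ω => hessForm ψ p.1 (eig p.1 p.2) :=
    measurable_hessForm h measurable_fst he
  have h2 : Measurable fun p : MatSpace m n × Ω => lambdaMin ψ p.1 :=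
    (continuous_lambdaMin h hm hn).measurable.comp measurable_fst
  simp only [not_le]
  exact measurableSet_lt h2 (h1.sub_const _)

/-- Fresh randomness: the point reached before iteration `i + 1` is independent of the random
input of that iteration. -/
lemma indepFun_trajectory (h : ContDiff ℝ 2 ψ)
    (he : Measurable fun p : MatSpace m n × Ω => eig p.1 p.2)
    (P : Measure Ω) [IsProbabilityMeasure P] (i : ℕ) :
    IndepFun (fun ω => trajectory ψ L₂ α eig K₁ ω i) (fun ω : ℕ → Ω => ω i)
      (Measure.infinitePi fun _ : ℕ => P) := by
  obtain ⟨ω₀⟩ : Nonempty Ω := P.nonempty_of_neZero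
  have hind : iIndepFun (fun (k : ℕ) (ω : ℕ → Ω) => ω k) (Measure.infinitePi fun _ : ℕ => P) :=
    iIndepFun_infinitePi (X := fun _ x => x) (fun _ => measurable_id)
  have h1 := hind.indepFun_finset (Finset.range i) {i} (by simp)
    (fun k => measurable_pi_apply k)
  set F : (Finset.range i → Ω) → ℕ → Ω :=
    fun r k => if hk : k ∈ Finset.range i then r ⟨k, hk⟩ else ω₀ with hF
  have hFm : Measurable F := by
    refine measurable_pi_lambda _ fun k => ?_
    by_cases hk : k ∈ Finset.range i
    · simpa only [hF, hk, dite_true] using measurable_pi_apply _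
    · simpa only [hF, hk, dite_false] using measurable_const
  have h2 := h1.comp ((measurable_trajectory (L₂ := L₂) (α := α) (K₁ := K₁) h he i).comp hFm)
    (measurable_pi_apply (⟨i, Finset.mem_singleton_self i⟩ : ({i} : Finset ℕ)))
  have e : (fun ω : ℕ → Ω => trajectory ψ L₂ α eig K₁ ω i) =
      ((fun ω => trajectory ψ L₂ α eig K₁ ω i) ∘ F) ∘
        fun (ω : ℕ → Ω) (k : Finset.range i) => ω k := by
    funext ω
    refine trajectory_congr fun k hk => ?_
    simp [hF, hk]
  rw [e]
  exact h2

lemma measure_trajectory_not_approx_le (h : ContDiff ℝ 2 ψ) (hm : 1 ≤ m) (hn : 1 ≤ n)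
    (P : Measure Ω) [IsProbabilityMeasure P] {δ' : ℝ} (he : IsEigRoutine ψ α δ' P eig) (i : ℕ) :
    Measure.infinitePi (fun _ : ℕ => P)
      {ω | ¬ (hessForm ψ (trajectory ψ L₂ α eig K₁ ω i)
          (eig (trajectory ψ L₂ α eig K₁ ω i) (ω i)) - α / 2 ≤
        lambdaMin ψ (trajectory ψ L₂ α eig K₁ ω i))} ≤ ENNReal.ofReal δ' := by
  have hS := measurableSet_not_approx (α := α) h hm hn he.measurable
  have hY := measurable_trajectory (L₂ := L₂) (α := α) (K₁ := K₁) h he.measurable i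
  have hX : Measurable fun ω : ℕ → Ω => ω i := measurable_pi_apply i
  have hmap := (indepFun_iff_map_prod_eq_prod_map_map hY.aemeasurable hX.aemeasurable).1
    (indepFun_trajectory (L₂ := L₂) (α := α) (K₁ := K₁) h he.measurable P i)
  have hP : (Measure.infinitePi fun _ : ℕ => P).map (fun ω => ω i) = P :=
    (measurePreserving_eval_infinitePi (fun _ : ℕ => P) i).map_eq
  have := Measure.isProbabilityMeasure_map (μ := Measure.infinitePi fun _ : ℕ => P)
    hY.aemeasurable
  calc _ = ((Measure.infinitePi fun _ : ℕ => P).map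
        fun ω => (trajectory ψ L₂ α eig K₁ ω i, ω i)) {p : MatSpace m n × Ω |
      ¬ (hessForm ψ p.1 (eig p.1 p.2) - α / 2 ≤ lambdaMin ψ p.1)} := by
        rw [Measure.map_apply (hY.prodMk hX) hS]; rfl
    _ ≤ ∫⁻ _, ENNReal.ofReal δ' ∂((Measure.infinitePi fun _ : ℕ => P).map
          fun ω => trajectory ψ L₂ α eig K₁ ω i) := by
        rw [hmap, hP, Measure.prod_apply hS]
        exact lintegral_mono fun K => he.approx K
    _ = ENNReal.ofReal δ' := by simp

/-- Union bound over the at most `1 + 12 L₂² Δ / α³` iterations. -/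
lemma measure_not_returns_good_le (h : HasLipschitzHessian L₂ ψ) (hm : 1 ≤ m) (hn : 1 ≤ n)
    (hL : 0 < L₂) (hα : 0 < α) (hδ : 0 < δ) (hΔ : ∀ K, ψ K₁ - ψ K ≤ Δ)
    (P : Measure Ω) [IsProbabilityMeasure P]
    (he : IsEigRoutine ψ α (innerDelta δ L₂ α Δ) P eig) :
    Measure.infinitePi (fun _ : ℕ => P)
      {ω | ¬ ∃ (j : ℕ) (K : MatSpace m n), ReturnsAt ψ L₂ α eig K₁ ω j K ∧
        -α ≤ lambdaMin ψ K} ≤ ENNReal.ofReal δ := by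
  set N := 1 + 12 * L₂ ^ 2 * Δ / α ^ 3 with hN
  have hΔ0 : 0 ≤ Δ := by simpa using hΔ K₁
  have hN0 : 0 < N := by positivity
  have hsub : {ω | ¬ ∃ (j : ℕ) (K : MatSpace m n), ReturnsAt ψ L₂ α eig K₁ ω j K ∧
        -α ≤ lambdaMin ψ K} ⊆ ⋃ i ∈ Finset.range ⌊N⌋₊,
      {ω | ¬ (hessForm ψ (trajectory ψ L₂ α eig K₁ ω i)
          (eig (trajectory ψ L₂ α eig K₁ ω i) (ω i)) - α / 2 ≤
        lambdaMin ψ (trajectory ψ L₂ α eig K₁ ω i))} := by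
    intro ω hω
    obtain ⟨j, K, hr⟩ := exists_returnsAt h hL hα hΔ he.norm_eq_one ω
    have hj := le_of_returnsAt h hL hα he.norm_eq_one hr
    have hjN : (j : ℝ) ≤ N := by
      refine hj.trans ?_
      rw [hN]; gcongr; exact hΔ K
    have hbad : ¬ -α ≤ lambdaMin ψ K := fun hg => hω ⟨j, K, hr, hg⟩
    obtain ⟨i, rfl, hi, hi'⟩ := hr
    have ht := trajectory_eq_of_iterate ω i K hi
    simp only [Set.mem_iUnion, Finset.mem_range]
    refine ⟨i, Nat.le_floor hjN, ?_⟩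
    simp only [Set.mem_ofPred_eq, ht]
    intro hle
    simp only [iterate, hi, Option.bind_some, step] at hi'
    split_ifs at hi' with hc
    exact hbad (by linarith)
  calc _ ≤ _ := measure_mono hsub
    _ ≤ ∑ _i ∈ Finset.range ⌊N⌋₊, ENNReal.ofReal (innerDelta δ L₂ α Δ) :=
        (measure_biUnion_finset_le _ _).trans (Finset.sum_le_sum fun i _ =>
          measure_trajectory_not_approx_le h.1 hm hn P he i)
    _ = ENNReal.ofReal (⌊N⌋₊ * innerDelta δ L₂ α Δ) := by
        rw [Finset.sum_const, Finset.card_range, nsmul_eq_mul,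
          ENNReal.ofReal_mul (by positivity), ENNReal.ofReal_natCast]
    _ ≤ ENNReal.ofReal δ := by
        refine ENNReal.ofReal_le_ofReal ?_
        rw [innerDelta, ← hN]
        calc (⌊N⌋₊ : ℝ) * (δ / N) ≤ N * (δ / N) := by
              gcongr; exact Nat.floor_le hN0.le
          _ = δ := by field_simp

end Probability

/-! ### Chebyshev polynomials of the fourth kind -/

section Chebyshev

/-- Chebyshev polynomials of the fourth kind, with the index shifted by one: `cheb (k + 1)` has
degree `k`, and `cheb k (cos θ) = sin ((k - 1/2) θ) / sin (θ / 2)`. Starting the recurrence at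
degree `-1` makes both initial values constants. -/
def cheb : ℕ → ℝ → ℝ
  | 0, _ => -1
  | 1, _ => 1
  | k + 2, y => 2 * y * cheb (k + 1) y - cheb k y

lemma cheb_cos_mul_sin (θ : ℝ) (k : ℕ) :
    cheb k (Real.cos (2 * θ)) * Real.sin θ = Real.sin ((2 * k - 1) * θ) := by
  induction k using Nat.twoStepInduction with
  | zero => simp [cheb]
  | one => simp [cheb]; ring_nf
  | more k h0 h1 =>
    have e1 : Real.sin ((2 * ((k + 2 : ℕ) : ℝ) - 1) * θ) =
        Real.sin ((2 * ((k + 1 : ℕ) : ℝ) - 1) * θ + 2 * θ) := by push_cast; ring_nf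
    have e0 : Real.sin ((2 * (k : ℝ) - 1) * θ) =
        Real.sin ((2 * ((k + 1 : ℕ) : ℝ) - 1) * θ - 2 * θ) := by push_cast; ring_nf
    rw [cheb, sub_mul, h0, mul_assoc, h1, e0, e1, Real.sin_add, Real.sin_sub]
    ring

lemma cheb_cosh_mul_sinh (t : ℝ) (k : ℕ) :
    cheb k (Real.cosh (2 * t)) * Real.sinh t = Real.sinh ((2 * k - 1) * t) := by
  induction k using Nat.twoStepInduction with
  | zero => simp [cheb]
  | one => simp [cheb]; ring_nf
  | more k h0 h1 =>
    have e1 : Real.sinh ((2 * ((k + 2 : ℕ) : ℝ) - 1) * t) =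
        Real.sinh ((2 * ((k + 1 : ℕ) : ℝ) - 1) * t + 2 * t) := by push_cast; ring_nf
    have e0 : Real.sinh ((2 * (k : ℝ) - 1) * t) =
        Real.sinh ((2 * ((k + 1 : ℕ) : ℝ) - 1) * t - 2 * t) := by push_cast; ring_nf
    rw [cheb, sub_mul, h0, mul_assoc, h1, e0, e1, Real.sinh_add, Real.sinh_sub]
    ring

/-- The weighted bound that distinguishes the fourth kind: with `y = cos (2 θ)` the left side is
`2 sin² ((2 k - 1) θ)`. -/
lemma cheb_sq_mul_one_sub_le (k : ℕ) {y : ℝ} (hy : -1 ≤ y) : cheb k y ^ 2 * (1 - y) ≤ 2 := by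
  rcases le_total y 1 with h | h
  · have hc : Real.cos (2 * (Real.arccos y / 2)) = y := by
      rw [mul_div_cancel₀ _ two_ne_zero, Real.cos_arccos hy h]
    set θ := Real.arccos y / 2
    have e : cheb k y ^ 2 * (1 - y) = 2 * Real.sin ((2 * k - 1) * θ) ^ 2 := by
      rw [← cheb_cos_mul_sin, hc, mul_pow]
      have : 1 - y = 2 * Real.sin θ ^ 2 := by
        rw [← hc, Real.cos_two_mul, Real.cos_sq']; ring
      rw [this]; ring
    rw [e]
    have := Real.sin_sq_le_one ((2 * k - 1) * θ)
    linarith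
  · nlinarith [sq_nonneg (cheb k y)]

lemma cheb_cosh_sq_mul (t : ℝ) (k : ℕ) :
    cheb k (Real.cosh (2 * t)) ^ 2 * (Real.cosh (2 * t) - 1) =
      2 * Real.sinh ((2 * k - 1) * t) ^ 2 := by
  rw [← cheb_cosh_mul_sinh, mul_pow]
  have : Real.cosh (2 * t) - 1 = 2 * Real.sinh t ^ 2 := by
    rw [Real.cosh_two_mul, Real.cosh_sq]; ring
  rw [this]; ring

lemma exists_cosh_two_mul_eq {y : ℝ} (hy : 1 ≤ y) : ∃ t, 0 ≤ t ∧ Real.cosh (2 * t) = y :=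
  ⟨Real.arcosh y / 2, by have := Real.arcosh_nonneg hy; positivity, by
    rw [mul_div_cancel₀ _ two_ne_zero, Real.cosh_arcosh hy]⟩

lemma cheb_sq_mul_mono (k : ℕ) {x y : ℝ} (hx : 1 ≤ x) (hxy : x ≤ y) :
    cheb (k + 1) x ^ 2 * (x - 1) ≤ cheb (k + 1) y ^ 2 * (y - 1) := by
  obtain ⟨s, hs, rfl⟩ := exists_cosh_two_mul_eq hx
  obtain ⟨t, ht, rfl⟩ := exists_cosh_two_mul_eq (hx.trans hxy)
  rw [Real.cosh_le_cosh, abs_of_nonneg (by positivity), abs_of_nonneg (by positivity)] at hxy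
  rw [cheb_cosh_sq_mul, cheb_cosh_sq_mul]
  have hk : (0 : ℝ) ≤ 2 * ((k + 1 : ℕ) : ℝ) - 1 := by
    push_cast; linarith [Nat.cast_nonneg (α := ℝ) k]
  have h0 : 0 ≤ Real.sinh ((2 * ((k + 1 : ℕ) : ℝ) - 1) * s) :=
    Real.sinh_nonneg_iff.2 (by positivity)
  have h1 : Real.sinh ((2 * ((k + 1 : ℕ) : ℝ) - 1) * s) ≤
      Real.sinh ((2 * ((k + 1 : ℕ) : ℝ) - 1) * t) := Real.sinh_le_sinh.2 (by gcongr; linarith)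
  gcongr

/-- Beyond `1` the polynomials grow like `exp (2 k √γ)`: the square root is what makes Chebyshev
filters faster than the power method. -/
lemma exp_le_cheb_sq_mul (k : ℕ) {γ : ℝ} (h0 : 0 ≤ γ) (h1 : γ ≤ 1) :
    Real.exp ((2 * k + 1) * Real.sqrt γ) / 2 - 1 ≤ cheb (k + 1) (1 + γ) ^ 2 * γ := by
  obtain ⟨t, ht, htγ⟩ := exists_cosh_two_mul_eq (y := 1 + γ) (by linarith)
  have e : cheb (k + 1) (1 + γ) ^ 2 * γ = Real.cosh ((2 * k + 1) * (2 * t)) - 1 := by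
    have := cheb_cosh_sq_mul t (k + 1)
    rw [htγ, add_sub_cancel_left] at this
    rw [this]
    have h2 : Real.cosh ((2 * k + 1) * (2 * t)) = Real.cosh (2 * ((2 * k + 1) * t)) := by ring_nf
    rw [h2, Real.cosh_two_mul, Real.cosh_sq]; push_cast; ring_nf
  -- `exp (γ / 2) ≤ 1 + γ = cosh (2 t) ≤ exp ((2 t)² / 2)`
  have ht2 : Real.sqrt γ ≤ 2 * t := by
    refine Real.sqrt_le_left (by positivity) |>.2 ?_
    have h3 := Real.cosh_le_exp_half_sq (2 * t)
    rw [htγ] at h3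
    have h4 : Real.exp (γ / 2) ≤ 1 + γ := by
      have h5 := Real.abs_exp_sub_one_sub_id_le (x := γ / 2) (by rw [abs_of_nonneg] <;> linarith)
      have := (abs_le.1 h5).2
      nlinarith
    have := Real.exp_le_exp.1 (h4.trans h3)
    linarith
  rw [e]
  have h6 : Real.exp ((2 * k + 1) * Real.sqrt γ) ≤ Real.exp ((2 * k + 1) * (2 * t)) :=
    Real.exp_le_exp.2 (by gcongr)
  rw [Real.cosh_eq ((2 * k + 1) * (2 * t))]
  have := Real.exp_pos (-((2 * k + 1) * (2 * t)))
  linarith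

lemma lt_cheb_sq_mul {γ B : ℝ} (h0 : 0 < γ) (h1 : γ ≤ 1) (hB : 0 ≤ B) {k : ℕ}
    (hk : Real.log (2 * (B + 1)) / (2 * Real.sqrt γ) ≤ k) :
    B < cheb (k + 1) (1 + γ) ^ 2 * γ := by
  have hs : 0 < Real.sqrt γ := Real.sqrt_pos.2 h0
  refine lt_of_lt_of_le ?_ (exp_le_cheb_sq_mul k h0.le h1)
  have h2 : Real.log (2 * (B + 1)) < (2 * k + 1) * Real.sqrt γ := by
    rw [div_le_iff₀ (by positivity)] at hk
    linarith
  rw [Real.log_lt_iff_lt_exp (by positivity)] at h2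
  linarith

lemma exists_lt_cheb_sq_mul {γ B : ℝ} (h0 : 0 < γ) (h1 : γ ≤ 1) (hB : 0 ≤ B) :
    ∃ k : ℕ, B < cheb (k + 1) (1 + γ) ^ 2 * γ :=
  let ⟨k, hk⟩ := exists_nat_ge (Real.log (2 * (B + 1)) / (2 * Real.sqrt γ))
  ⟨k, lt_cheb_sq_mul h0 h1 hB hk⟩

/-- The first degree at which the polynomial with gap `γ` amplifies by more than `B`. -/
def filterDegree (γ B : ℝ) : ℕ := sInf {k | B < cheb (k + 1) (1 + γ) ^ 2 * γ}

lemma lt_cheb_filterDegree {γ B : ℝ} (h0 : 0 < γ) (h1 : γ ≤ 1) (hB : 0 ≤ B) :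
    B < cheb (filterDegree γ B + 1) (1 + γ) ^ 2 * γ :=
  Nat.sInf_mem (s := {k | B < cheb (k + 1) (1 + γ) ^ 2 * γ}) (exists_lt_cheb_sq_mul h0 h1 hB)

lemma cheb_le_of_lt_filterDegree {γ B : ℝ} {k : ℕ} (hk : k < filterDegree γ B) :
    cheb (k + 1) (1 + γ) ^ 2 * γ ≤ B :=
  not_lt.1 (Nat.notMem_of_lt_sInf hk)

lemma filterDegree_le {γ B : ℝ} (h0 : 0 < γ) (h1 : γ ≤ 1) (hB : 0 ≤ B) :
    (filterDegree γ B : ℝ) ≤ Real.log (2 * (B + 1)) / (2 * Real.sqrt γ) + 1 := by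
  have hl : 0 ≤ Real.log (2 * (B + 1)) := Real.log_nonneg (by linarith)
  by_contra hlt
  rw [not_le] at hlt
  have hlt' := (Nat.ceil_lt_add_one (a := Real.log (2 * (B + 1)) / (2 * Real.sqrt γ))
    (by positivity)).trans hlt
  exact (cheb_le_of_lt_filterDegree (Nat.cast_lt.1 hlt')).not_gt
    (lt_cheb_sq_mul h0 h1 hB (Nat.le_ceil _))

end Chebyshev

/-! ### Gaussian start vectors -/

section Gaussian
variable {E : Type*} [NormedAddCommGroup E] [InnerProductSpace ℝ E] [FiniteDimensional ℝ E]
  [MeasurableSpace E] [BorelSpace E]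

lemma map_inner_stdGaussian {e : E} (he : ‖e‖ = 1) :
    (stdGaussian E).map (fun g => inner ℝ e g) = gaussianReal 0 1 := by
  have h1 := IsGaussian.map_eq_gaussianReal (μ := stdGaussian E) (innerSL ℝ e)
  rw [integral_strongDual_stdGaussian, variance_dual_stdGaussian, innerSL_apply_norm, he] at h1
  have : (1 ^ 2 : ℝ).toNNReal = 1 := by simp
  rw [this] at h1
  exact h1

/-- The standard Gaussian density is at most `1 / √(2π) ≤ 1 / 2`. -/
lemma gaussianReal_abs_le (a : ℝ) :
    gaussianReal 0 1 {x | |x| ≤ a} ≤ ENNReal.ofReal a := by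
  have hset : {x : ℝ | |x| ≤ a} = Set.Icc (-a) a := by ext x; simp [abs_le]
  have hpdf : ∀ x, gaussianPDF 0 1 x ≤ ENNReal.ofReal (1 / 2) := by
    intro x
    refine ENNReal.ofReal_le_ofReal ?_
    rw [gaussianPDFReal]
    have h2 : (2 : ℝ) ≤ Real.sqrt (2 * Real.pi * ((1 : NNReal) : ℝ)) := by
      refine Real.le_sqrt_of_sq_le ?_
      have := Real.pi_gt_three
      push_cast
      linarith
    have h3 : Real.exp (-(x - 0) ^ 2 / (2 * ((1 : NNReal) : ℝ))) ≤ 1 := by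
      rw [Real.exp_le_one_iff]
      push_cast
      nlinarith [sq_nonneg x]
    have h4 : (Real.sqrt (2 * Real.pi * ((1 : NNReal) : ℝ)))⁻¹ ≤ 1 / 2 := by
      rw [inv_le_comm₀ (by linarith) (by norm_num)]; simpa using h2
    calc _ ≤ (1 / 2 : ℝ) * 1 := by gcongr
      _ = 1 / 2 := mul_one _
  rw [hset, gaussianReal_apply 0 (by norm_num)]
  calc _ ≤ ∫⁻ _ in Set.Icc (-a) a, ENNReal.ofReal (1 / 2) := lintegral_mono fun x => hpdf x
    _ = ENNReal.ofReal a := by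
      rw [setLIntegral_const, Real.volume_Icc, ← ENNReal.ofReal_mul (by norm_num)]
      congr 1; ring

lemma integral_inner_sq_stdGaussian {e : E} (he : ‖e‖ = 1) :
    ∫ g, inner ℝ e g ^ 2 ∂(stdGaussian E) = 1 := by
  have h1 := variance_dual_stdGaussian (innerSL ℝ e)
  rw [innerSL_apply_norm, he, variance_of_integral_eq_zero (by fun_prop)
    (integral_strongDual_stdGaussian _)] at h1
  simpa using h1

lemma integrable_inner_sq_stdGaussian (e : E) :
    Integrable (fun g => inner ℝ e g ^ 2) (stdGaussian E) :=
  (IsGaussian.memLp_dual (stdGaussian E) (innerSL ℝ e) 2 (by norm_num)).integrable_sq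

lemma integral_norm_sq_stdGaussian :
    ∫ g, ‖g‖ ^ 2 ∂(stdGaussian E) = Module.finrank ℝ E := by
  have b := stdOrthonormalBasis ℝ E
  simp_rw [← b.sum_sq_inner_right]
  rw [integral_finsetSum _ fun i _ => integrable_inner_sq_stdGaussian (b i)]
  simp [integral_inner_sq_stdGaussian]

lemma integrable_norm_sq_stdGaussian : Integrable (fun g => ‖g‖ ^ 2) (stdGaussian E) := by
  have b := stdOrthonormalBasis ℝ E
  simp_rw [← b.sum_sq_inner_right]
  exact integrable_finsetSum _ fun i _ => integrable_inner_sq_stdGaussian (b i)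

/-- A Gaussian start vector has, in every fixed direction, a component that is not too small
compared with its norm. -/
lemma stdGaussian_not_aligned_le {e : E} (he : ‖e‖ = 1) {η : ℝ} (hη : 0 < η) :
    stdGaussian E {g | ¬ (inner ℝ e g ≠ 0 ∧
      2 * ‖g‖ ^ 2 ≤ 16 * Module.finrank ℝ E / η ^ 3 * inner ℝ e g ^ 2)} ≤ ENNReal.ofReal η := by
  set d : ℝ := ((Module.finrank ℝ E : ℕ) : ℝ) with hd
  have hd0 : 0 < d := by
    have : Nontrivial E := ⟨e, 0, by rintro rfl; simp at he⟩
    exact Nat.cast_pos.2 Module.finrank_pos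
  have hsub : {g : E | ¬ (inner ℝ e g ≠ 0 ∧ 2 * ‖g‖ ^ 2 ≤ 16 * d / η ^ 3 * inner ℝ e g ^ 2)} ⊆
      {g | |inner ℝ e g| ≤ η / 2} ∪ {g | 2 * d / η ≤ ‖g‖ ^ 2} := by
    intro g hg
    by_contra hn
    simp only [Set.mem_union, Set.mem_ofPred_eq, not_or, not_le] at hn
    refine hg ⟨?_, ?_⟩
    · intro h0
      rw [h0, abs_zero] at hn
      linarith [hn.1]
    · have h1 : (η / 2) ^ 2 ≤ inner ℝ e g ^ 2 := by
        rw [← sq_abs (inner ℝ e g)]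
        gcongr
        exact hn.1.le
      calc 2 * ‖g‖ ^ 2 ≤ 2 * (2 * d / η) := by linarith [hn.2]
        _ = 16 * d / η ^ 3 * (η / 2) ^ 2 := by field_simp; norm_num
        _ ≤ _ := by gcongr
  have hm : Measurable fun g : E => inner ℝ e g := (innerSL ℝ e).continuous.measurable
  -- The component along `e` is a standard Gaussian number; the norm is bounded by Markov's
  -- inequality. Each event gets half of `η`.
  have hA : stdGaussian E {g | |inner ℝ e g| ≤ η / 2} ≤ ENNReal.ofReal (η / 2) := by
    have h1 := gaussianReal_abs_le (η / 2)
    have hS : MeasurableSet {x : ℝ | |x| ≤ η / 2} :=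
      measurableSet_le measurable_norm measurable_const
    rwa [← map_inner_stdGaussian he, Measure.map_apply hm hS] at h1
  have hB : stdGaussian E {g | 2 * d / η ≤ ‖g‖ ^ 2} ≤ ENNReal.ofReal (η / 2) := by
    have h1 := mul_meas_ge_le_integral_of_nonneg (μ := stdGaussian E)
      (Filter.Eventually.of_forall fun g => sq_nonneg ‖g‖) integrable_norm_sq_stdGaussian
      (2 * d / η)
    rw [integral_norm_sq_stdGaussian, ← hd] at h1
    rw [← ENNReal.ofReal_toReal (measure_ne_top (stdGaussian E) {g | 2 * d / η ≤ ‖g‖ ^ 2})]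
    refine ENNReal.ofReal_le_ofReal ?_
    change 2 * d / η * ((stdGaussian E) {g | 2 * d / η ≤ ‖g‖ ^ 2}).toReal ≤ d at h1
    rw [div_mul_eq_mul_div, div_le_iff₀ hη] at h1
    nlinarith
  calc _ ≤ _ := measure_mono hsub
    _ ≤ _ := measure_union_le _ _
    _ ≤ ENNReal.ofReal (η / 2) + ENNReal.ofReal (η / 2) := add_le_add hA hB
    _ = ENNReal.ofReal η := by
      rw [← ENNReal.ofReal_add (by positivity) (by positivity), add_halves]

end Gaussian

/-! ### The Chebyshev-filtered eigenvector search -/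

section Filter
variable {m n : ℕ} {ψ : MatSpace m n → ℝ} {L₁ : ℝ}

/-- The Chebyshev polynomials of the Hessian shifted by `θ` and scaled by `2 L₁`, that is
`cheb k (1 + (θ - ∇²ψ(K)) / (2 L₁)) g`, computed by the three-term recurrence. -/
def chebVec (ψ : MatSpace m n → ℝ) (L₁ : ℝ) (K : MatSpace m n) (θ : ℝ) (g : MatSpace m n) :
    ℕ → MatSpace m n
  | 0 => -g
  | 1 => g
  | k + 2 => (2 + θ / L₁) • chebVec ψ L₁ K θ g (k + 1) +
      (-1 / L₁) • hess ψ K (chebVec ψ L₁ K θ g (k + 1)) - chebVec ψ L₁ K θ g k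

lemma inner_chebVec (h : ContDiff ℝ 2 ψ) (hL : 0 < L₁) {K e : MatSpace m n} {μ : ℝ}
    (he : hess ψ K e = μ • e) (θ : ℝ) (g : MatSpace m n) (k : ℕ) :
    inner ℝ e (chebVec ψ L₁ K θ g k) = cheb k (1 + (θ - μ) / (2 * L₁)) * inner ℝ e g := by
  induction k using Nat.twoStepInduction with
  | zero => simp [chebVec, cheb]
  | one => simp [chebVec, cheb]
  | more k h0 h1 =>
    rw [chebVec, cheb, inner_sub_right, inner_add_right, real_inner_smul_right,
      real_inner_smul_right, inner_hess_eigenvector h he, h0, h1]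
    field_simp
    ring

/-- The filter reaches the level `θ` of the Rayleigh quotient if the smallest eigenvalue lies a
little below `θ`: the eigenvalues above `θ` contribute at most `2 ‖g‖²` in total, because
`cheb k y ^ 2 * (1 - y) ≤ 2`, and the smallest one contributes less than `-B ⟨b i₀, g⟩²`. -/
lemma hessForm_chebVec_lt (h : ContDiff ℝ 2 ψ) (hs : IsSmooth L₁ ψ) (hL : 0 < L₁)
    {K : MatSpace m n} {θ γ B : ℝ} {k : ℕ} {g : MatSpace m n}
    {ι : Type*} [Fintype ι] (b : OrthonormalBasis ι ℝ (MatSpace m n)) (ev : ι → ℝ)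
    (hb : ∀ i, hess ψ K (b i) = ev i • b i) (i₀ : ι)
    (hθ : -(3 * L₁) ≤ θ) (hγ : 0 ≤ γ) (hθγ : ev i₀ + 2 * L₁ * γ ≤ θ)
    (hB : B < cheb (k + 1) (1 + γ) ^ 2 * γ)
    (hg0 : inner ℝ (b i₀) g ≠ 0) (hg : 2 * ‖g‖ ^ 2 ≤ B * inner ℝ (b i₀) g ^ 2) :
    hessForm ψ K (chebVec ψ L₁ K θ g (k + 1)) <
      θ * inner ℝ (chebVec ψ L₁ K θ g (k + 1)) (chebVec ψ L₁ K θ g (k + 1)) := by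
  classical
  set w := chebVec ψ L₁ K θ g (k + 1) with hw
  set y : ι → ℝ := fun i => 1 + (θ - ev i) / (2 * L₁) with hy
  have hw' : ∀ i, inner ℝ (b i) w = cheb (k + 1) (y i) * inner ℝ (b i) g := fun i =>
    inner_chebVec h hL (hb i) θ g (k + 1)
  have hev : ∀ i, ev i ≤ L₁ := fun i => by
    have h1 := abs_hessForm_le (ψ := ψ) K (b i)
    rw [hessForm, hb, real_inner_smul_right, real_inner_self_eq_norm_sq, b.norm_eq_one] at h1
    have h2 := norm_hess_le hs hL.le K
    have := le_abs_self (ev i * 1 ^ 2)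
    linarith
  set c := cheb (k + 1) (1 + γ) ^ 2 * γ with hc
  -- The bound `2 ⟨b i, g⟩²` holds for every `i`; at `i₀` the gain `c ⟨b i₀, g⟩²` can be subtracted.
  have key : ∀ i, cheb (k + 1) (y i) ^ 2 * (1 - y i) * inner ℝ (b i) g ^ 2 ≤
      2 * inner ℝ (b i) g ^ 2 - if i = i₀ then c * inner ℝ (b i) g ^ 2 else 0 := by
    intro i
    split_ifs with hi
    · have h1 : 1 + γ ≤ y i := by
        rw [hi, hy]
        have : γ ≤ (θ - ev i₀) / (2 * L₁) := by
          rw [le_div_iff₀ (by positivity)]; linarith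
        linarith
      have h2 := cheb_sq_mul_mono k (by linarith : (1 : ℝ) ≤ 1 + γ) h1
      rw [add_sub_cancel_left, ← hc] at h2
      nlinarith [sq_nonneg (inner ℝ (b i) g)]
    · have h1 : -1 ≤ y i := by
        have : -2 ≤ (θ - ev i) / (2 * L₁) := by
          rw [le_div_iff₀ (by positivity)]; linarith [hev i]
        simp only [hy]
        linarith
      have := cheb_sq_mul_one_sub_le (k + 1) h1
      rw [sub_zero]
      gcongr
  have e : hessForm ψ K w - θ * inner ℝ w w =
      2 * L₁ * ∑ i, cheb (k + 1) (y i) ^ 2 * (1 - y i) * inner ℝ (b i) g ^ 2 := by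
    rw [hessForm_eq_sum h b ev hb, real_inner_self_eq_norm_sq, ← b.sum_sq_inner_right,
      Finset.mul_sum, Finset.mul_sum, ← Finset.sum_sub_distrib]
    refine Finset.sum_congr rfl fun i _ => ?_
    rw [hw', hy]
    field_simp
    ring
  have hsum : ∑ i, cheb (k + 1) (y i) ^ 2 * (1 - y i) * inner ℝ (b i) g ^ 2 ≤
      2 * ‖g‖ ^ 2 - c * inner ℝ (b i₀) g ^ 2 := by
    refine (Finset.sum_le_sum fun i _ => key i).trans_eq ?_
    rw [Finset.sum_sub_distrib, ← Finset.mul_sum, b.sum_sq_inner_right]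
    simp
  have hpos : 0 < inner ℝ (b i₀) g ^ 2 := by positivity
  have hneg : ∑ i, cheb (k + 1) (y i) ^ 2 * (1 - y i) * inner ℝ (b i) g ^ 2 < 0 := by
    nlinarith
  have := mul_neg_of_pos_of_neg (by positivity : 0 < 2 * L₁) hneg
  linarith

/-- One stage of the search: apply the filter aimed `7 ε / 16` below the Rayleigh quotient of `v`
and keep the result if it reaches that level. -/
def filterStep (ψ : MatSpace m n → ℝ) (L₁ B : ℝ) (K g : MatSpace m n) (ε : ℝ)
    (v : MatSpace m n) : MatSpace m n :=
  let θ := hessForm ψ K v - 7 / 16 * ε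
  let w := chebVec ψ L₁ K θ g (filterDegree (ε / (16 * L₁)) B + 1)
  if θ * inner ℝ w w ≤ hessForm ψ K w then v else (1 / Real.sqrt (inner ℝ w w)) • w

/-- The error bound before stage `i` of the search. -/
def gap (L₁ : ℝ) (i : ℕ) : ℝ := 2 * L₁ * (9 / 16) ^ i

/-- The search vector before stage `i`. -/
def searchVec (ψ : MatSpace m n → ℝ) (L₁ B : ℝ) (K g : MatSpace m n) : ℕ → MatSpace m n
  | 0 => firstUnit m n
  | i + 1 => filterStep ψ L₁ B K g (gap L₁ i) (searchVec ψ L₁ B K g i)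

/-- The number of stages after which the error bound is below `α / 2`. -/
def numStages (L₁ α : ℝ) : ℕ := sInf {i | gap L₁ i < α / 2}

/-- The amplification that outweighs an unfavourable start vector, except with probability `η`. -/
def amplification (m n : ℕ) (η : ℝ) : ℝ := 16 * m * n / η ^ 3

/-- The eigenvector computation: all stages use the same Gaussian start vector. -/
def chebEig (ψ : MatSpace m n → ℝ) (L₁ α η : ℝ) (K : MatSpace m n) (u : ℕ → MatSpace m n) :
    MatSpace m n :=
  searchVec ψ L₁ (amplification m n η) K (u 0) (numStages L₁ α)

lemma hessForm_smul (K v : MatSpace m n) (c : ℝ) :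
    hessForm ψ K (c • v) = c ^ 2 * hessForm ψ K v := by
  simp only [hessForm, map_smul, real_inner_smul_left, real_inner_smul_right]; ring

/-- A vector with Rayleigh quotient strictly below some level is nonzero. -/
lemma inner_self_pos_of_hessForm_lt {K w : MatSpace m n} {θ : ℝ}
    (hw : hessForm ψ K w < θ * inner ℝ w w) : 0 < inner ℝ w w := by
  rw [real_inner_self_eq_norm_sq]
  have : w ≠ 0 := by
    rintro rfl
    simp [hessForm] at hw
  positivity

lemma norm_filterStep {B ε : ℝ} {K g v : MatSpace m n} (hv : ‖v‖ = 1) :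
    ‖filterStep ψ L₁ B K g ε v‖ = 1 := by
  unfold filterStep
  extract_lets θ w
  split_ifs with hc
  · exact hv
  · have hpos := inner_self_pos_of_hessForm_lt (not_le.1 hc)
    rw [norm_smul, ← norm_eq_sqrt_real_inner, Real.norm_of_nonneg (by positivity)]
    rw [real_inner_self_eq_norm_sq] at hpos
    have : ‖w‖ ≠ 0 := by rintro h0; simp [h0] at hpos
    field_simp

lemma norm_firstUnit (hm : 1 ≤ m) (hn : 1 ≤ n) : ‖firstUnit m n‖ = 1 := by
  rw [firstUnit, dif_pos ⟨hm, hn⟩]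
  simp

lemma norm_searchVec (hm : 1 ≤ m) (hn : 1 ≤ n) {B : ℝ} {K g : MatSpace m n} (i : ℕ) :
    ‖searchVec ψ L₁ B K g i‖ = 1 := by
  cases i with
  | zero => exact norm_firstUnit hm hn
  | succ i => exact norm_filterStep (norm_searchVec hm hn i)

lemma gap_pos (hL : 0 < L₁) (i : ℕ) : 0 < gap L₁ i := by unfold gap; positivity

lemma gap_le (hL : 0 < L₁) (i : ℕ) : gap L₁ i ≤ 2 * L₁ := by
  have : ((9 : ℝ) / 16) ^ i ≤ 1 := pow_le_one₀ (by norm_num) (by norm_num)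
  unfold gap
  nlinarith

lemma gap_succ (i : ℕ) : gap L₁ (i + 1) = 9 / 16 * gap L₁ i := by unfold gap; ring

lemma gap_numStages_lt {α : ℝ} (hα : 0 < α) : gap L₁ (numStages L₁ α) < α / 2 := by
  refine Nat.sInf_mem (s := {i | gap L₁ i < α / 2}) ?_
  have := (tendsto_pow_atTop_nhds_zero_of_lt_one (by norm_num : (0 : ℝ) ≤ 9 / 16)
    (by norm_num)).const_mul (2 * L₁)
  rw [mul_zero] at this
  obtain ⟨i, hi⟩ := (this.eventually (gt_mem_nhds (by positivity : 0 < α / 2))).exists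
  exact ⟨i, hi⟩

lemma le_gap_of_lt_numStages {α : ℝ} {i : ℕ} (hi : i < numStages L₁ α) : α / 2 ≤ gap L₁ i :=
  not_lt.1 (Nat.notMem_of_lt_sInf hi)

/-- If the smallest eigenvalue is more than `9 ε / 16` below the current Rayleigh quotient, the
filter lowers that quotient by `7 ε / 16`; in both cases the error drops to `9 ε / 16`. -/
lemma hessForm_filterStep_le (h : ContDiff ℝ 2 ψ) (hs : IsSmooth L₁ ψ) (hL : 0 < L₁)
    {K : MatSpace m n} {B ε : ℝ} {g v : MatSpace m n}
    {ι : Type*} [Fintype ι] (b : OrthonormalBasis ι ℝ (MatSpace m n)) (ev : ι → ℝ)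
    (hb : ∀ i, hess ψ K (b i) = ev i • b i) (i₀ : ι)
    (hB : 0 ≤ B) (hg0 : inner ℝ (b i₀) g ≠ 0) (hg : 2 * ‖g‖ ^ 2 ≤ B * inner ℝ (b i₀) g ^ 2)
    (hε : 0 < ε) (hεL : ε ≤ 2 * L₁) (hv : ‖v‖ = 1) (hle : hessForm ψ K v ≤ ev i₀ + ε) :
    hessForm ψ K (filterStep ψ L₁ B K g ε v) ≤ ev i₀ + 9 / 16 * ε := by
  unfold filterStep
  extract_lets θ w
  have hθ : θ = hessForm ψ K v - 7 / 16 * ε := rfl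
  split_ifs with hc
  -- A rejected output means that the smallest eigenvalue was not far below the level `θ`.
  · by_contra hlt
    rw [not_le] at hlt
    refine hc.not_gt (hessForm_chebVec_lt h hs hL b ev hb i₀ (γ := ε / (16 * L₁)) ?_
      (by positivity) ?_ (lt_cheb_filterDegree (by positivity) ?_ hB) hg0 hg)
    · have h1 := (abs_le.1 (abs_hessForm_le (ψ := ψ) K v)).1
      rw [hv] at h1
      have h2 := norm_hess_le hs hL.le K
      linarith
    · have : 2 * L₁ * (ε / (16 * L₁)) = ε / 8 := by field_simp; norm_num
      rw [this]
      linarith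
    · rw [div_le_one (by positivity)]; linarith
  · rw [not_le] at hc
    have hpos := inner_self_pos_of_hessForm_lt hc
    rw [hessForm_smul, div_pow, one_pow, Real.sq_sqrt hpos.le, one_div, inv_mul_eq_div]
    have : hessForm ψ K w / inner ℝ w w ≤ θ := by
      rw [div_le_iff₀ hpos]; exact hc.le
    linarith

lemma hessForm_searchVec_le (h : ContDiff ℝ 2 ψ) (hs : IsSmooth L₁ ψ) (hL : 0 < L₁)
    (hm : 1 ≤ m) (hn : 1 ≤ n) {K : MatSpace m n} {B : ℝ} {g : MatSpace m n}
    {ι : Type*} [Fintype ι] (b : OrthonormalBasis ι ℝ (MatSpace m n)) (ev : ι → ℝ)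
    (hb : ∀ i, hess ψ K (b i) = ev i • b i) (i₀ : ι) (he : ev i₀ = lambdaMin ψ K)
    (hB : 0 ≤ B) (hg0 : inner ℝ (b i₀) g ≠ 0) (hg : 2 * ‖g‖ ^ 2 ≤ B * inner ℝ (b i₀) g ^ 2)
    (i : ℕ) : hessForm ψ K (searchVec ψ L₁ B K g i) ≤ lambdaMin ψ K + gap L₁ i := by
  induction i with
  | zero =>
    have h1 := (abs_le.1 (abs_hessForm_le (ψ := ψ) K (firstUnit m n))).2
    rw [norm_firstUnit hm hn] at h1
    have h2 := norm_hess_le hs hL.le K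
    have h3 := neg_le_lambdaMin h hs hL.le hm hn K
    simp only [searchVec, gap, pow_zero]
    linarith
  | succ i ih =>
    rw [searchVec, gap_succ, ← he]
    exact hessForm_filterStep_le h hs hL b ev hb i₀ hB hg0 hg (gap_pos hL i) (gap_le hL i)
      (norm_searchVec hm hn i) (he ▸ ih)

lemma amplification_nonneg {η : ℝ} (hη : 0 < η) : 0 ≤ amplification m n η := by
  unfold amplification; positivity

section Measurability
variable {Ξ : Type*} [MeasurableSpace Ξ]

lemma measurable_chebVec (h : ContDiff ℝ 2 ψ) {f g : Ξ → MatSpace m n} {θ : Ξ → ℝ}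
    (hf : Measurable f) (hg : Measurable g) (hθ : Measurable θ) (k : ℕ) :
    Measurable fun x => chebVec ψ L₁ (f x) (θ x) (g x) k := by
  induction k using Nat.twoStepInduction with
  | zero => exact hg.neg
  | one => exact hg
  | more k h0 h1 =>
    simp only [chebVec]
    have h2 : Measurable fun p : MatSpace m n × MatSpace m n => hess ψ p.1 p.2 :=
      (((continuous_hess h).comp continuous_fst).clm_apply continuous_snd).measurable
    have h3 : Measurable fun x => hess ψ (f x) (chebVec ψ L₁ (f x) (θ x) (g x) (k + 1)) :=
      h2.comp (hf.prodMk h1)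
    exact ((((hθ.div_const L₁).const_add 2).smul h1).add (h3.const_smul (-1 / L₁))).sub h0

lemma measurable_filterStep (h : ContDiff ℝ 2 ψ) {B ε : ℝ} {f g v : Ξ → MatSpace m n}
    (hf : Measurable f) (hg : Measurable g) (hv : Measurable v) :
    Measurable fun x => filterStep ψ L₁ B (f x) (g x) ε (v x) := by
  unfold filterStep
  have hθ : Measurable fun x => hessForm ψ (f x) (v x) - 7 / 16 * ε :=
    (measurable_hessForm h hf hv).sub_const _
  have hw := measurable_chebVec (L₁ := L₁) h hf hg hθ (filterDegree (ε / (16 * L₁)) B + 1)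
  have hn := hw.inner (𝕜 := ℝ) hw
  exact Measurable.ite (measurableSet_le (hθ.mul hn) (measurable_hessForm h hf hw)) hv
    ((hn.sqrt.const_div 1).smul hw)

lemma measurable_searchVec (h : ContDiff ℝ 2 ψ) {B : ℝ} {f g : Ξ → MatSpace m n}
    (hf : Measurable f) (hg : Measurable g) (i : ℕ) :
    Measurable fun x => searchVec ψ L₁ B (f x) (g x) i := by
  induction i with
  | zero => exact measurable_const
  | succ i ih => exact measurable_filterStep h hf hg ih

end Measurability

lemma isEigRoutine_chebEig (h : ContDiff ℝ 2 ψ) (hs : IsSmooth L₁ ψ) (hL : 0 < L₁)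
    (hm : 1 ≤ m) (hn : 1 ≤ n) {α η : ℝ} (hα : 0 < α) (hη : 0 < η) :
    IsEigRoutine ψ α η (gaussLaw m n) (chebEig ψ L₁ α η) where
  measurable := measurable_searchVec h measurable_fst
    ((measurable_pi_apply 0).comp measurable_snd) _
  norm_eq_one _ _ := norm_searchVec hm hn _
  approx K := by
    obtain ⟨b, ev, i₀, hb, he, -⟩ := exists_eigenbasis h hm hn K
    set good : Set (MatSpace m n) := {g | inner ℝ (b i₀) g ≠ 0 ∧
      2 * ‖g‖ ^ 2 ≤ 16 * Module.finrank ℝ (MatSpace m n) / η ^ 3 * inner ℝ (b i₀) g ^ 2}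
      with hgood
    have hmeas : MeasurableSet goodᶜ := by
      have h1 : Measurable fun g : MatSpace m n => inner ℝ (b i₀) g :=
        (innerSL ℝ (b i₀)).continuous.measurable
      refine MeasurableSet.compl (MeasurableSet.inter ?_ ?_)
      · exact (measurableSet_eq_fun h1 measurable_const).compl
      · exact measurableSet_le ((measurable_norm.pow_const 2).const_mul 2)
          ((h1.pow_const 2).const_mul _)
    have hmap : (gaussLaw m n).map (fun u => u 0) = stdGaussian (MatSpace m n) :=
      (measurePreserving_eval_infinitePi (fun _ : ℕ => stdGaussian (MatSpace m n)) 0).map_eq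
    have hsub : {u | ¬ (hessForm ψ K (chebEig ψ L₁ α η K u) - α / 2 ≤ lambdaMin ψ K)} ⊆
        (fun u : ℕ → MatSpace m n => u 0) ⁻¹' goodᶜ := by
      intro u hu hg
      refine hu ?_
      have hd : (16 : ℝ) * Module.finrank ℝ (MatSpace m n) / η ^ 3 = amplification m n η := by
        simp [amplification, mul_assoc]
      obtain ⟨hg0, hg1⟩ := hg
      rw [hd] at hg1
      have h1 := hessForm_searchVec_le h hs hL hm hn b ev hb i₀ he (amplification_nonneg hη)
        hg0 hg1 (numStages L₁ α)
      have h2 := gap_numStages_lt (L₁ := L₁) hα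
      rw [chebEig]
      linarith
    calc _ ≤ _ := measure_mono hsub
      _ = stdGaussian (MatSpace m n) goodᶜ := by
        rw [← hmap, Measure.map_apply (measurable_pi_apply 0) hmeas]
      _ ≤ _ := stdGaussian_not_aligned_le (b.norm_eq_one i₀) hη

end Filter

/-! ### Straight-line code and counted loops -/

section Blocks
variable {m n : ℕ} {ψ : MatSpace m n → ℝ} {u : ℕ → MatSpace m n}

/-- A straight-line program. There is no empty program, so the value at `[]` is arbitrary. -/
def block : List Instr → Prog
  | [] => .instr (.const 0 0)
  | [i] => .instr i
  | i :: j :: l => .seq (.instr i) (block (j :: l))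

/-- The state after a list of instructions. -/
def run (ψ : MatSpace m n → ℝ) (u : ℕ → MatSpace m n) (l : List Instr) (σ : State m n) :
    State m n :=
  l.foldl (fun σ i => i.eval ψ u σ) σ

lemma exec_block {l : List Instr} (hl : l ≠ []) (σ : State m n) :
    Exec ψ u (block l) σ (run ψ u l σ) l.length := by
  induction l generalizing σ with
  | nil => exact absurd rfl hl
  | cons i l ih =>
    cases l with
    | nil => exact .instr i σ
    | cons j l =>
      have := Exec.seq (Exec.instr (ψ := ψ) (u := u) i σ) (ih (by simp) (i.eval ψ u σ))
      rw [add_comm] at this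
      exact this

/-- A loop whose number of rounds is known from an invariant indexed by the round. -/
lemma exec_while {a b D : ℕ} {p : Prog} {I : ℕ → State m n → Prop} {c : ℕ → ℕ}
    (hbody : ∀ i < D, ∀ σ, I i σ →
      σ.scal a ≤ σ.scal b ∧ ∃ τ t, Exec ψ u p σ τ t ∧ t ≤ c i ∧ I (i + 1) τ)
    (hend : ∀ σ, I D σ → ¬ σ.scal a ≤ σ.scal b) {σ : State m n} (h0 : I 0 σ) :
    ∃ τ t, Exec ψ u (.whileLe a b p) σ τ t ∧
      t ≤ ∑ i ∈ Finset.range D, (c i + 1) + 1 ∧ I D τ := by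
  induction D generalizing I c σ with
  | zero => exact ⟨σ, 1, .whileFalse (hend σ h0), by simp, h0⟩
  | succ D ih =>
    obtain ⟨hle, τ, s, he, hs, hI⟩ := hbody 0 (by omega) σ h0
    obtain ⟨ρ, t, he', ht, hI'⟩ := ih (I := fun i => I (i + 1)) (c := fun i => c (i + 1))
      (fun i hi => hbody (i + 1) (by omega)) hend hI
    refine ⟨ρ, s + t + 1, .whileTrue hle he he', ?_, hI'⟩
    rw [Finset.sum_range_succ']
    omega

end Blocks

/-! ### The program -/

section Program

/-- Constants, start vectors and parameters: the amplification goes to scalar register `8`, half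
of `α` to `9`, the first gap `2 L₁` to `10`, the Gaussian vector to vector register `1` and the
search vector to `2`. -/
def setupCode : List Instr :=
  [.const 9 12, .mul 8 9 4, .mul 8 8 4, .mul 8 8 7, .mul 9 5 5, .mul 9 9 5, .div 8 8 9,
   .const 13 1, .add 8 13 8, .div 8 6 8, .mul 9 8 8, .mul 9 9 8, .const 8 16, .mul 8 8 1,
   .mul 8 8 2, .div 8 8 9, .const 15 2, .div 9 5 15, .mul 10 15 3, .const 12 16, .mul 12 12 3,
   .const 14 (-1), .const 16 0, .const 17 (7 / 16), .const 18 (9 / 16), .div 19 14 3,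
   .gauss 1, .unitVec 2]

/-- Start of a stage: the level `θ` goes to scalar register `20`, the coefficients of the vector
recurrence and of the scalar recurrence to `22` and `24`, and the first two values of these
recurrences to vector registers `3`, `4` and scalar registers `25`, `26`. -/
def stageCode : List Instr :=
  [.hessVec 5 0 2, .inner 20 2 5, .mul 21 17 10, .sub 20 20 21, .div 22 20 3, .add 22 15 22,
   .div 23 10 12, .add 24 13 23, .mul 24 15 24, .const 25 (-1), .const 26 1, .lin 3 14 1 16 1,
   .lin 4 13 1 16 1, .mul 27 26 26, .mul 27 27 23]

/-- One round of the three-term recurrence, for the vectors and, in parallel, for the scalar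
amplification factor that decides when to stop. -/
def recurrenceCode : List Instr :=
  [.hessVec 5 0 4, .lin 5 22 4 19 5, .lin 5 13 5 14 3, .lin 3 13 4 16 4, .lin 4 13 5 16 5,
   .mul 28 24 26, .sub 28 28 25, .add 25 26 16, .add 26 28 16, .mul 27 26 26, .mul 27 27 23]

/-- The two sides of the acceptance test of a stage. -/
def testCode : List Instr := [.hessVec 5 0 4, .inner 21 4 5, .inner 22 4 4, .mul 20 20 22]

/-- Replace the search vector by the normalized result of the filter. -/
def acceptCode : List Instr := [.sqrt 22 22, .div 22 13 22, .lin 2 22 4 16 4]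

/-- One stage of the search. The constant loaded on rejection only fills the empty branch. -/
def stageProg : Prog :=
  .seq (block stageCode) (.seq (.whileLe 27 8 (block recurrenceCode)) (.seq (block testCode)
    (.seq (.ifLe 20 21 (.instr (.const 28 0)) (block acceptCode)) (.instr (.mul 10 10 18)))))

/-- The test of the curvature. -/
def curvatureCode : List Instr := [.hessVec 5 0 2, .inner 20 2 5, .sub 21 16 9]

/-- The sign of scalar register `21`, into register `22`. -/
def signProg : Prog := .ifLe 16 21 (.instr (.const 22 1)) (.instr (.const 22 (-1)))

/-- The descent step, with the curvature in scalar register `20` and the sign in `22`. -/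
def moveCode : List Instr :=
  [.sub 20 16 20, .mul 20 15 20, .div 20 20 4, .mul 20 20 22, .sub 20 16 20, .lin 0 13 0 20 2,
   .const 0 1]

/-- What follows the eigenvector computation: scalar register `0` ends as `1` to continue and as `0`
to stop. -/
def stepProg : Prog :=
  .seq (block curvatureCode) (.ifLe 20 21
    (.seq (block [.grad 5 0, .inner 21 2 5]) (.seq signProg (block moveCode)))
    (.instr (.const 0 0)))

/-- One iteration of negative curvature descent. -/
def iterationProg : Prog :=
  .seq (block setupCode) (.seq (.whileLe 9 10 stageProg) stepProg)

end Program

/-! ### Execution of the program -/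

section Exec
variable {m n : ℕ} {ψ : MatSpace m n → ℝ} {u : ℕ → MatSpace m n} {L₁ L₂ α δ Δ B : ℝ}
  {K g : MatSpace m n}

/-- The registers that keep their values during the search. -/
structure Fixed (L₁ L₂ α B : ℝ) (K g : MatSpace m n) (σ : State m n) : Prop where
  vec_zero : σ.vec 0 = K
  vec_one : σ.vec 1 = g
  scal_three : σ.scal 3 = L₁
  scal_four : σ.scal 4 = L₂
  scal_eight : σ.scal 8 = B
  scal_nine : σ.scal 9 = α / 2
  scal_twelve : σ.scal 12 = 16 * L₁
  scal_thirteen : σ.scal 13 = 1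
  scal_fourteen : σ.scal 14 = -1
  scal_fifteen : σ.scal 15 = 2
  scal_sixteen : σ.scal 16 = 0
  scal_seventeen : σ.scal 17 = 7 / 16
  scal_eighteen : σ.scal 18 = 9 / 16
  scal_nineteen : σ.scal 19 = -1 / L₁

/-- Memory at the start of a stage with gap `ε` and search vector `v`. -/
structure StageState (L₁ L₂ α B : ℝ) (K g : MatSpace m n) (ε : ℝ) (v : MatSpace m n)
    (σ : State m n) : Prop extends Fixed L₁ L₂ α B K g σ where
  vec_two : σ.vec 2 = v
  scal_ten : σ.scal 10 = ε

/-- Memory after `k` rounds of the recurrence in a stage. -/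
structure RecurrenceState (ψ : MatSpace m n → ℝ) (L₁ L₂ α B : ℝ) (K g : MatSpace m n) (ε : ℝ)
    (v : MatSpace m n) (θ : ℝ) (k : ℕ) (σ : State m n) : Prop
    extends StageState L₁ L₂ α B K g ε v σ where
  vec_three : σ.vec 3 = chebVec ψ L₁ K θ g k
  vec_four : σ.vec 4 = chebVec ψ L₁ K θ g (k + 1)
  scal_twenty : σ.scal 20 = θ
  scal_twentyTwo : σ.scal 22 = 2 + θ / L₁
  scal_twentyThree : σ.scal 23 = ε / (16 * L₁)
  scal_twentyFour : σ.scal 24 = 2 * (1 + ε / (16 * L₁))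
  scal_twentyFive : σ.scal 25 = cheb k (1 + ε / (16 * L₁))
  scal_twentySix : σ.scal 26 = cheb (k + 1) (1 + ε / (16 * L₁))
  scal_twentySeven : σ.scal 27 = cheb (k + 1) (1 + ε / (16 * L₁)) ^ 2 * (ε / (16 * L₁))

lemma run_setupCode :
    StageState L₁ L₂ α (amplification m n (innerDelta δ L₂ α Δ)) K (u 0) (2 * L₁) (firstUnit m n)
      (run ψ u setupCode (initial m n L₁ L₂ α δ Δ K)) := by
  refine ⟨⟨?_, ?_, ?_, ?_, ?_, ?_, ?_, ?_, ?_, ?_, ?_, ?_, ?_, ?_⟩, ?_, ?_⟩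
  all_goals simp [run, setupCode, Instr.eval, State.setVec, State.setScal, initial]
  simp only [amplification, innerDelta]
  ring_nf

lemma run_stageCode {ε : ℝ} {v : MatSpace m n} {σ : State m n}
    (h : StageState L₁ L₂ α B K g ε v σ) :
    RecurrenceState ψ L₁ L₂ α B K g ε v (hessForm ψ K v - 7 / 16 * ε) 0
      (run ψ u stageCode σ) := by
  obtain ⟨⟨h1, h2, h3, h4, h5, h6, h7, h8, h9, h10, h11, h12, h13, h14⟩, h15, h16⟩ := h
  refine ⟨⟨⟨?_, ?_, ?_, ?_, ?_, ?_, ?_, ?_, ?_, ?_, ?_, ?_, ?_, ?_⟩, ?_, ?_⟩,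
    ?_, ?_, ?_, ?_, ?_, ?_, ?_, ?_, ?_⟩
  all_goals simp [run, stageCode, Instr.eval, State.setVec, State.setScal, chebVec, cheb,
    hessForm, *]

lemma run_recurrenceCode {ε θ : ℝ} {v : MatSpace m n} {k : ℕ} {σ : State m n}
    (h : RecurrenceState ψ L₁ L₂ α B K g ε v θ k σ) :
    RecurrenceState ψ L₁ L₂ α B K g ε v θ (k + 1) (run ψ u recurrenceCode σ) := by
  obtain ⟨⟨⟨h1, h2, h3, h4, h5, h6, h7, h8, h9, h10, h11, h12, h13, h14⟩, h15, h16⟩,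
    h17, h18, h19, h20, h21, h22, h23, h24, h25⟩ := h
  refine ⟨⟨⟨?_, ?_, ?_, ?_, ?_, ?_, ?_, ?_, ?_, ?_, ?_, ?_, ?_, ?_⟩, ?_, ?_⟩,
    ?_, ?_, ?_, ?_, ?_, ?_, ?_, ?_, ?_⟩
  all_goals simp [run, recurrenceCode, Instr.eval, State.setVec, State.setScal, *]
  · simp only [chebVec, sub_eq_add_neg]
  · simp only [cheb]
  · simp only [cheb, sq, true_or]

lemma exec_stageProg (hL : 0 < L₁) (hB : 0 ≤ B) {ε : ℝ} (hε : 0 < ε) (hεL : ε ≤ 2 * L₁)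
    {v : MatSpace m n} {σ : State m n} (h : StageState L₁ L₂ α B K g ε v σ) :
    ∃ τ t, Exec ψ u stageProg σ τ t ∧ t ≤ 12 * filterDegree (ε / (16 * L₁)) B + 25 ∧
      StageState L₁ L₂ α B K g (9 / 16 * ε) (filterStep ψ L₁ B K g ε v) τ := by
  set γ := ε / (16 * L₁) with hγ
  set θ := hessForm ψ K v - 7 / 16 * ε with hθ
  have hγ0 : 0 < γ := by positivity
  have hγ1 : γ ≤ 1 := by rw [hγ, div_le_one (by positivity)]; linarith
  set D := filterDegree γ B with hD
  obtain ⟨τ, t, he, ht, hτ⟩ := exec_while (ψ := ψ) (u := u) (a := 27) (b := 8) (D := D)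
    (p := block recurrenceCode) (I := RecurrenceState ψ L₁ L₂ α B K g ε v θ) (c := fun _ => 11)
    (fun i hi σ hσ => ⟨by
        rw [hσ.scal_twentySeven, hσ.scal_eight]; exact cheb_le_of_lt_filterDegree hi,
      _, _, exec_block (by simp [recurrenceCode]) σ, le_rfl, run_recurrenceCode hσ⟩)
    (fun σ hσ => by
      rw [hσ.scal_twentySeven, hσ.scal_eight, not_le]; exact lt_cheb_filterDegree hγ0 hγ1 hB)
    (run_stageCode h)
  have hw : filterStep ψ L₁ B K g ε v = if θ * inner ℝ (chebVec ψ L₁ K θ g (D + 1))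
      (chebVec ψ L₁ K θ g (D + 1)) ≤ hessForm ψ K (chebVec ψ L₁ K θ g (D + 1)) then v
      else (1 / Real.sqrt (inner ℝ (chebVec ψ L₁ K θ g (D + 1))
        (chebVec ψ L₁ K θ g (D + 1)))) • chebVec ψ L₁ K θ g (D + 1) := rfl
  rw [hw]
  set w := chebVec ψ L₁ K θ g (D + 1) with hwdef
  obtain ⟨⟨⟨h1, h2, h3, h4, h5, h6, h7, h8, h9, h10, h11, h12, h13, h14⟩, h15, h16⟩,
    h17, h18, h19, h20, h21, h22, h23, h24, h25⟩ := hτ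
  have ht' : t ≤ 12 * D + 1 := by simpa [mul_comm] using ht
  have e20 : (run ψ u testCode τ).scal 20 = θ * inner ℝ w w := by
    simp [run, testCode, Instr.eval, State.setVec, State.setScal, *]
  have e21 : (run ψ u testCode τ).scal 21 = hessForm ψ K w := by
    simp [run, testCode, Instr.eval, State.setVec, State.setScal, hessForm, *]
  have hs := exec_block (ψ := ψ) (u := u) (l := stageCode) (by simp [stageCode]) σ
  have htest := exec_block (ψ := ψ) (u := u) (l := testCode) (by simp [testCode]) τ
  by_cases hc : θ * inner ℝ w w ≤ hessForm ψ K w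
  · refine ⟨_, _, .seq hs (.seq he (.seq htest (.seq (.ifTrue (by rwa [e20, e21]) (.instr _ _))
      (.instr _ _)))), ?_, ?_⟩
    · simp only [stageCode, testCode, List.length]
      omega
    · rw [if_pos hc]
      refine ⟨⟨?_, ?_, ?_, ?_, ?_, ?_, ?_, ?_, ?_, ?_, ?_, ?_, ?_, ?_⟩, ?_, ?_⟩
      all_goals simp [run, testCode, Instr.eval, State.setVec, State.setScal, *]
      ring
  · refine ⟨_, _, .seq hs (.seq he (.seq htest (.seq (.ifFalse (by rwa [e20, e21])
      (exec_block (by simp [acceptCode]) _)) (.instr _ _)))), ?_, ?_⟩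
    · simp only [stageCode, testCode, acceptCode, List.length]
      omega
    · rw [if_neg hc]
      refine ⟨⟨?_, ?_, ?_, ?_, ?_, ?_, ?_, ?_, ?_, ?_, ?_, ?_, ?_, ?_⟩, ?_, ?_⟩
      all_goals simp [run, testCode, acceptCode, Instr.eval, State.setVec, State.setScal, *]
      ring

lemma exec_search (hL : 0 < L₁) (hα : 0 < α) (hB : 0 ≤ B) {σ : State m n}
    (h : StageState L₁ L₂ α B K g (2 * L₁) (firstUnit m n) σ) :
    ∃ τ t, Exec ψ u (.whileLe 9 10 stageProg) σ τ t ∧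
      t ≤ ∑ i ∈ Finset.range (numStages L₁ α),
        (12 * filterDegree (gap L₁ i / (16 * L₁)) B + 26) + 1 ∧
      StageState L₁ L₂ α B K g (gap L₁ (numStages L₁ α))
        (searchVec ψ L₁ B K g (numStages L₁ α)) τ := by
  refine exec_while (I := fun i => StageState L₁ L₂ α B K g (gap L₁ i) (searchVec ψ L₁ B K g i))
    (c := fun i => 12 * filterDegree (gap L₁ i / (16 * L₁)) B + 25)
    (fun i hi σ hσ => ⟨?_, ?_⟩) (fun σ hσ => ?_) ?_
  · rw [hσ.scal_nine, hσ.scal_ten]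
    exact le_gap_of_lt_numStages hi
  · rw [gap_succ]
    exact exec_stageProg hL hB (gap_pos hL i) (gap_le hL i) hσ
  · rw [hσ.scal_nine, hσ.scal_ten, not_le]
    exact gap_numStages_lt hα
  · simpa [gap, searchVec] using h

lemma exec_signProg {σ : State m n} (h : σ.scal 16 = 0) :
    Exec ψ u signProg σ (σ.setScal 22 (sgn (σ.scal 21))) 2 := by
  unfold sgn signProg
  split_ifs with hc
  · have := Exec.ifTrue (ψ := ψ) (u := u) (a := 16) (b := 21) (q := .instr (.const 22 (-1)))
      (by rwa [h]) (Exec.instr (.const 22 1) σ)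
    simpa [Instr.eval] using this
  · have := Exec.ifFalse (ψ := ψ) (u := u) (a := 16) (b := 21) (p := .instr (.const 22 1))
      (by rwa [h]) (Exec.instr (.const 22 (-1)) σ)
    simpa [Instr.eval] using this

lemma exec_stepProg (hα : 0 < α) {ε : ℝ} {v : MatSpace m n} {σ : State m n}
    (h : StageState L₁ L₂ α B K g ε v σ) :
    ∃ τ t, Exec ψ u stepProg σ τ t ∧ t ≤ 15 ∧ τ.output = step ψ L₂ α K v := by
  obtain ⟨⟨h1, h2, h3, h4, h5, h6, h7, h8, h9, h10, h11, h12, h13, h14⟩, h15, h16⟩ := h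
  have hcur := exec_block (ψ := ψ) (u := u) (l := curvatureCode) (by simp [curvatureCode]) σ
  have e20 : (run ψ u curvatureCode σ).scal 20 = hessForm ψ K v := by
    simp [run, curvatureCode, Instr.eval, State.setVec, State.setScal, hessForm, *]
  have e21 : (run ψ u curvatureCode σ).scal 21 = -α / 2 := by
    simp [run, curvatureCode, Instr.eval, State.setVec, State.setScal, *]
    ring
  unfold step
  split_ifs with hc
  · have hg := exec_block (ψ := ψ) (u := u) (l := [.grad 5 0, .inner 21 2 5]) (by simp)
      (run ψ u curvatureCode σ)
    refine ⟨_, _, .seq hcur (.ifTrue (by rwa [e20, e21]) (.seq hg (.seq (exec_signProg ?_)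
      (exec_block (by simp [moveCode]) _)))), ?_, ?_⟩
    · simp [run, curvatureCode, Instr.eval, State.setVec, State.setScal, *]
    · simp [curvatureCode, moveCode]
    -- The program computes `|h|` as `-h`, which is correct on this branch.
    · have habs : |hessForm ψ K v| = -hessForm ψ K v := abs_of_nonpos (by linarith)
      rw [habs]
      simp [run, curvatureCode, moveCode, Instr.eval, State.setVec, State.setScal,
        State.output, hessForm, sub_eq_add_neg, *]
  · refine ⟨_, _, .seq hcur (.ifFalse (by rwa [e20, e21]) (.instr _ _)), ?_, ?_⟩
    · simp [curvatureCode]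
    · simp [Instr.eval, State.setScal, State.output]

lemma exec_iterationProg (hL : 0 < L₁) (hα : 0 < α) (hη : 0 < innerDelta δ L₂ α Δ) :
    ∃ τ t, Exec ψ u iterationProg (initial m n L₁ L₂ α δ Δ K) τ t ∧
      t ≤ ∑ i ∈ Finset.range (numStages L₁ α), (12 * filterDegree (gap L₁ i / (16 * L₁))
        (amplification m n (innerDelta δ L₂ α Δ)) + 26) + 44 ∧
      τ.output = step ψ L₂ α K (chebEig ψ L₁ α (innerDelta δ L₂ α Δ) K u) := by
  have hs := exec_block (ψ := ψ) (u := u) (l := setupCode) (by simp [setupCode])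
    (initial m n L₁ L₂ α δ Δ K)
  obtain ⟨τ, t, he, ht, hτ⟩ := exec_search (ψ := ψ) (u := u) hL hα (amplification_nonneg hη)
    (run_setupCode (ψ := ψ) (u := u) (L₁ := L₁) (L₂ := L₂) (α := α) (δ := δ) (Δ := Δ) (K := K))
  obtain ⟨ρ, s, he', hs', hρ⟩ := exec_stepProg (ψ := ψ) (u := u) hα hτ
  refine ⟨ρ, _, .seq hs (.seq he he'), ?_, hρ⟩
  simp only [setupCode, List.length]
  omega

end Exec

/-! ### Running time -/

section Cost

/-- The amplification is polynomial in `mn / η`, so its logarithm is of the order of the logarithm in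
the running time. -/
lemma log_amplification_le {m n : ℕ} (hm : 1 ≤ m) (hn : 1 ≤ n) {η : ℝ} (h0 : 0 < η)
    (h1 : η ≤ 1) : Real.log (2 * (amplification m n η + 1)) ≤
      7 * max 1 (Real.log ((m : ℝ) * n / η)) := by
  have hd : (1 : ℝ) ≤ (m : ℝ) * n := by exact_mod_cast Nat.mul_pos hm hn
  set d : ℝ := (m : ℝ) * n with hdd
  have hX : 1 ≤ d / η := by rw [one_le_div h0]; linarith
  have hB : amplification m n η ≤ 16 * (d / η) ^ 3 := by
    have : d ≤ d ^ 3 := le_self_pow₀ hd (by norm_num)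
    rw [amplification, mul_assoc, ← hdd, div_pow, ← mul_div_assoc]
    gcongr
  have hX3 : 1 ≤ (d / η) ^ 3 := one_le_pow₀ hX
  have h34 : Real.log 34 ≤ 4 := by
    rw [Real.log_le_iff_le_exp (by norm_num)]
    have h2 := Real.exp_one_gt_d9
    have h3 : Real.exp 4 = Real.exp 1 ^ 4 := by rw [← Real.exp_nat_mul]; norm_num
    rw [h3]
    calc (34 : ℝ) ≤ 2.7 ^ 4 := by norm_num
      _ ≤ _ := by gcongr; linarith
  have hA := amplification_nonneg (m := m) (n := n) h0
  calc _ ≤ Real.log (34 * (d / η) ^ 3) := Real.log_le_log (by positivity) (by linarith)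
    _ = Real.log 34 + 3 * Real.log (d / η) := by
      rw [Real.log_mul (by norm_num) (by positivity), Real.log_pow]; norm_num
    _ ≤ _ := by
      have h5 := le_max_left 1 (Real.log (d / η))
      have h6 := le_max_right 1 (Real.log (d / η))
      linarith

lemma stage_cost_le {L₁ B l : ℝ} (hL : 0 < L₁) (hB : 0 ≤ B) (hl : 1 ≤ l)
    (hlog : Real.log (2 * (B + 1)) ≤ 7 * l) (i : ℕ) :
    (12 * filterDegree (gap L₁ i / (16 * L₁)) B + 26 : ℝ) ≤ 170 * l * (4 / 3) ^ i := by
  have hγ0 : 0 < gap L₁ i / (16 * L₁) := div_pos (gap_pos hL i) (by positivity)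
  have hγ1 : gap L₁ i / (16 * L₁) ≤ 1 := by
    rw [div_le_one (by positivity)]; linarith [gap_le hL i]
  have hs : (3 / 4 : ℝ) ^ i / 3 ≤ Real.sqrt (gap L₁ i / (16 * L₁)) := by
    refine Real.le_sqrt_of_sq_le ?_
    have e : gap L₁ i / (16 * L₁) = (9 / 16) ^ i / 8 := by
      unfold gap; field_simp; norm_num
    rw [e, div_pow, ← pow_mul, mul_comm i, pow_mul]
    norm_num
    have : (0 : ℝ) < (9 / 16) ^ i := by positivity
    linarith
  have hD := filterDegree_le hγ0 hγ1 hB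
  have h1 : Real.log (2 * (B + 1)) / (2 * Real.sqrt (gap L₁ i / (16 * L₁))) ≤
      7 * l / (2 * ((3 / 4 : ℝ) ^ i / 3)) := by gcongr
  have h2 : 7 * l / (2 * ((3 / 4 : ℝ) ^ i / 3)) = 21 / 2 * l * (4 / 3) ^ i := by
    have : ((4 : ℝ) / 3) ^ i = ((3 / 4) ^ i)⁻¹ := by rw [← inv_pow]; norm_num
    rw [this]; field_simp; norm_num
  have h3 : 1 ≤ l * (4 / 3 : ℝ) ^ i :=
    one_le_mul_of_one_le_of_one_le hl (one_le_pow₀ (by norm_num))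
  nlinarith

/-- The last stage still has gap at least `α / 2`, that is `(16 / 9) ^ i ≤ 4 L₁ / α`. -/
lemma pow_numStages_le {L₁ α : ℝ} (hα : 0 < α) (hαL : α ≤ L₁) :
    (4 / 3 : ℝ) ^ numStages L₁ α ≤ 8 / 3 * Real.sqrt (L₁ / α) := by
  have hs : 1 ≤ Real.sqrt (L₁ / α) := by
    rw [Real.one_le_sqrt, one_le_div hα]; exact hαL
  rcases hM : numStages L₁ α with _ | i
  · rw [pow_zero]; linarith
  · have h1 := le_gap_of_lt_numStages (L₁ := L₁) (α := α) (i := i) (by omega)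
    have h2 : ((4 / 3 : ℝ) ^ i / 2) ^ 2 ≤ L₁ / α := by
      have e : ((4 / 3 : ℝ) ^ i) ^ 2 * (9 / 16) ^ i = 1 := by
        rw [← pow_mul, mul_comm i, pow_mul, ← mul_pow]; norm_num
      rw [le_div_iff₀ hα]
      have h3 : ((4 / 3 : ℝ) ^ i) ^ 2 * (α / 2) ≤ ((4 / 3 : ℝ) ^ i) ^ 2 * gap L₁ i := by gcongr
      have h4 : ((4 / 3 : ℝ) ^ i) ^ 2 * gap L₁ i = 2 * L₁ := by
        rw [gap, mul_left_comm, e, mul_one]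
      nlinarith
    have h5 := Real.le_sqrt_of_sq_le h2
    rw [pow_succ]
    linarith

/-- The costs of the stages grow geometrically, so that their sum is governed by the last stage,
whose gap is of order `α`. -/
lemma total_cost_le {L₁ α B l : ℝ} (hα : 0 < α) (hαL : α ≤ L₁) (hB : 0 ≤ B)
    (hl : 1 ≤ l) (hlog : Real.log (2 * (B + 1)) ≤ 7 * l) {t : ℕ}
    (ht : t ≤ ∑ i ∈ Finset.range (numStages L₁ α),
      (12 * filterDegree (gap L₁ i / (16 * L₁)) B + 26) + 44) :
    (t : ℝ) ≤ 1500 * (Real.sqrt (L₁ / α) * l) := by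
  have hL : 0 < L₁ := hα.trans_le hαL
  have hs : 1 ≤ Real.sqrt (L₁ / α) := by
    rw [Real.one_le_sqrt, one_le_div hα]; exact hαL
  have h1 : (t : ℝ) ≤ ∑ i ∈ Finset.range (numStages L₁ α),
      (12 * filterDegree (gap L₁ i / (16 * L₁)) B + 26 : ℝ) + 44 := by exact_mod_cast ht
  have h2 : ∑ i ∈ Finset.range (numStages L₁ α),
      (12 * filterDegree (gap L₁ i / (16 * L₁)) B + 26 : ℝ) ≤
      170 * l * (3 * (4 / 3) ^ numStages L₁ α) := by
    refine (Finset.sum_le_sum fun i _ => stage_cost_le hL hB hl hlog i).trans ?_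
    rw [← Finset.mul_sum, geom_sum_eq (by norm_num)]
    gcongr
    rw [div_le_iff₀ (by norm_num)]
    linarith
  have h3 := pow_numStages_le hα hαL
  have h4 : 170 * l * (3 * (4 / 3 : ℝ) ^ numStages L₁ α) ≤
      170 * l * (3 * (8 / 3 * Real.sqrt (L₁ / α))) := by gcongr
  have h5 : 1 ≤ Real.sqrt (L₁ / α) * l := one_le_mul_of_one_le_of_one_le hs hl
  nlinarith

end Cost

end NCD

end

theorem theorem8 :
    ∃ (prog : NCD.Prog) (C : ℝ), 0 < C ∧
    ∀ (m n : ℕ) (L₁ L₂ α δ Δ : ℝ) (ψ : NCD.MatSpace m n → ℝ) (K₁ : NCD.MatSpace m n),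
    1 ≤ m → 1 ≤ n → 0 < L₂ → 0 < α → α ≤ L₁ → 0 < δ → δ < 1 →
    NCD.IsSmooth L₁ ψ → NCD.HasLipschitzHessian L₂ ψ →
    -- `Δ` is an optimality gap of `ψ` at `K₁`
    (∀ K, ψ K₁ - ψ K ≤ Δ) →
    -- for every implementation of the eigenvector computation
    (∀ (Ω : Type*) [MeasurableSpace Ω] (P : MeasureTheory.Measure Ω)
      [MeasureTheory.IsProbabilityMeasure P]
      (eig : NCD.MatSpace m n → Ω → NCD.MatSpace m n),
      NCD.IsEigRoutine ψ α (NCD.innerDelta δ L₂ α Δ) P eig →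
      -- the algorithm always terminates, with the stated bound on the iteration
      (∀ ω : ℕ → Ω, ∃ (j : ℕ) (K : NCD.MatSpace m n),
        NCD.ReturnsAt ψ L₂ α eig K₁ ω j K ∧
        (j : ℝ) ≤ 1 + 12 * L₂ ^ 2 * (ψ K₁ - ψ K) / α ^ 3 ∧
        1 + 12 * L₂ ^ 2 * (ψ K₁ - ψ K) / α ^ 3 ≤ 1 + 12 * L₂ ^ 2 * Δ / α ^ 3) ∧
      -- the returned point is good, except with probability at most `δ`
      MeasureTheory.Measure.infinitePi (fun _ : ℕ => P)
        {ω | ¬ ∃ (j : ℕ) (K : NCD.MatSpace m n),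
          NCD.ReturnsAt ψ L₂ α eig K₁ ω j K ∧ -α ≤ NCD.lambdaMin ψ K} ≤ ENNReal.ofReal δ) ∧
    -- the program performs one whole iteration, with such an eigenvector computation, in the
    -- stated time if every operation takes time `T`
    (∃ eig : NCD.MatSpace m n → (ℕ → NCD.MatSpace m n) → NCD.MatSpace m n,
      NCD.IsEigRoutine ψ α (NCD.innerDelta δ L₂ α Δ) (NCD.gaussLaw m n) eig ∧
      ∀ (K : NCD.MatSpace m n) (u : ℕ → NCD.MatSpace m n),
      ∃ (τ : NCD.State m n) (t : ℕ),
        NCD.Exec ψ u prog (NCD.initial m n L₁ L₂ α δ Δ K) τ t ∧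
        τ.output = NCD.step ψ L₂ α K (eig K u) ∧
        ∀ T : ℝ, 0 < T →
          (t : ℝ) * T ≤ C * (T * Real.sqrt (L₁ / α) *
            max 1 (Real.log ((m : ℝ) * n / δ * (1 + 12 * L₂ ^ 2 * Δ / α ^ 3))))) := by
  refine ⟨NCD.iterationProg, 1500, by norm_num, ?_⟩
  intro m n L₁ L₂ α δ Δ ψ K₁ hm hn hL₂ hα hαL hδ hδ1 hs hH hΔ
  have hΔ0 : 0 ≤ Δ := by simpa using hΔ K₁
  have hL₁ : 0 < L₁ := hα.trans_le hαL
  have hN : 1 ≤ 1 + 12 * L₂ ^ 2 * Δ / α ^ 3 := by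
    have : 0 ≤ 12 * L₂ ^ 2 * Δ / α ^ 3 := by positivity
    linarith
  have hη : 0 < NCD.innerDelta δ L₂ α Δ := div_pos hδ (by linarith)
  have hη1 : NCD.innerDelta δ L₂ α Δ ≤ 1 := by
    rw [NCD.innerDelta, div_le_one (by linarith)]; linarith
  refine ⟨?_, NCD.chebEig ψ L₁ α (NCD.innerDelta δ L₂ α Δ),
    NCD.isEigRoutine_chebEig hH.1 hs hL₁ hm hn hα hη, ?_⟩
  · intro Ω _ P _ eig heig
    refine ⟨fun ω => ?_, NCD.measure_not_returns_good_le hH hm hn hL₂ hα hδ hΔ P heig⟩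
    obtain ⟨j, K, hr⟩ := NCD.exists_returnsAt hH hL₂ hα hΔ heig.norm_eq_one ω
    refine ⟨j, K, hr, NCD.le_of_returnsAt hH hL₂ hα heig.norm_eq_one hr, ?_⟩
    gcongr
    exact hΔ K
  · intro K u
    obtain ⟨τ, t, he, ht, hτ⟩ := NCD.exec_iterationProg (ψ := ψ) (u := u) (K := K) hL₁ hα hη
    refine ⟨τ, t, he, hτ, fun T hT => ?_⟩
    have e : (m : ℝ) * n / NCD.innerDelta δ L₂ α Δ =
        (m : ℝ) * n / δ * (1 + 12 * L₂ ^ 2 * Δ / α ^ 3) := by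
      rw [NCD.innerDelta, div_div_eq_mul_div, div_mul_eq_mul_div]
    have hlog := NCD.log_amplification_le hm hn hη hη1
    rw [e] at hlog
    have hc := NCD.total_cost_le hα hαL (NCD.amplification_nonneg hη) (le_max_left _ _) hlog ht
    calc (t : ℝ) * T ≤ _ := mul_le_mul_of_nonneg_right hc hT.le
      _ = _ := by ring
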